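/- Let $D$ be an oriented smooth Riemannian manifold of dimension $n\ge 2$ (Hausdorff, second countable, without boundary), with volume form $dV$, Hodge star $\star$ and $\boldsymbol\delta:=\star\,\mathrm d\,\star$ on forms. Let $(W^i)_i$ and $(B^j)_j$ be two at most countable families, each consisting of independent Brownian motions with respect to a common filtration. Let $a,R\in\mathbb R$, let $e(\rho,s)$ be an internal energy function, and let smooth vector fields $\xi_i$ and smooth $2$-forms $\sigma_j$ on $D$ be given. Densities are written $\rho=(\star\rho)\,dV$, $\tilde n=(\star\tilde n)\,dV$, and for a $1$-form density $\mu=\boldsymbol\mu\otimes dV$ one writes $\mu/\tilde n:=\boldsymbol\mu/\star\tilde n$. Consider the Hamiltonians $$\mathcal H=\int_D\frac1{2\rho}\Big|M-\frac{a\rho}{\tilde n}\mu\Big|^2+\rho\,e(\rho,s)+\frac{R^2}{2}\Big|\mathrm d\frac{\mu}{\tilde n}\Big|^2\,dV,\qquad \mathcal H_i=\Big\langle M-\frac{a\rho}{\tilde n}\mu,\ \xi_i\Big\rangle,\qquad h_j=\int_D(\boldsymbol\delta\sigma_j)^\sharp\lrcorner\frac{\mu}{\tilde n}\,dV,$$ where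 densities and $1$-form densities in the integrands stand for their coefficients with respect to $dV$. The stochastic (SALT) compressible Hall MHD system is the system of stochastic Lie–Poisson equations for the $1$-form densities $M,\mu$, the densities $\rho,\tilde n$ and the function $s$, $$\mathrm dM=-\operatorname{ad}^*_{\mathrm dX}M-\mathrm d\Lambda_\rho\diamond\rho-\mathrm d\Lambda_s\diamond s,\quad \mathrm d\rho=-\mathcal L_{\mathrm dX}\rho,\quad \mathrm ds=-\mathcal L_{\mathrm dX}s,\quad \mathrm d\mu=-\operatorname{ad}^*_{\mathrm d\tilde X}\mu-\mathrm d\Lambda_{\tilde n}\diamond\tilde n,\quad \mathrm d\tilde n=-\mathcal L_{\mathrm d\tilde X}\tilde n,$$ where $(\mathrm dX,\mathrm d\Lambda_\rho,\mathrm d\Lambda_s,\mathrm d\tilde X,\mathrm d\Lambda_{\tilde n})$ is the vector of variational derivatives with respect to $(M,\rho,s,\mu,\tilde n)$ of $$\mathcal H\,\mathrm dt+\sum_i\mathcal H_i\circ\mathrm dW^i_t+\sum_j h_j\circ\mathrm dB^j_t ,$$ with Stratonovich integrals (if a family is infinite, the sum over it is assumed to converge unconditionally in probability). Here $\operatorname{ad}^*_X$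 is the Lie derivative of $1$-form densities, $\lambda\diamond\rho=\rho\,\mathrm d\lambda$ for a function $\lambda$ and a density $\rho$, and $p\diamond s=-p\,\mathrm ds$ for a density $p$ and a function $s$. Let $(M,\rho,s,\mu,\tilde n)$ be an adapted solution of this system, smooth in space, continuous in time, and with $\star\rho$ and $\star\tilde n$ nowhere zero, on a stochastic time interval $[0,\tau]$, where $\tau\le\infty$ is a stopping time. Then $\mathrm d(a\rho+\tilde n)=0$: almost surely, $a\rho_t+\tilde n_t=a\rho_0+\tilde n_0$ on $D$ for all $t\in[0,\tau]$, $t<\infty$. In particular, if $a\rho_0+\tilde n_0=0$ almost surely, then almost surely $a\rho_t+\tilde n_t=0$ for all $t\in[0,\tau]$, $t<\infty$. -/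

import Mathlib

open MeasureTheory ProbabilityTheory Filter Topology Bundle Manifold
open scoped NNReal ENNReal ContDiff

noncomputable section

namespace HallMHD

/-! ### Multilinear algebra -/

section Algebra

variable {V : Type*} [AddCommGroup V] [Module ℝ V] [TopologicalSpace V]

/-- Interior product of a vector with an alternating form: `(v ⌟ θ)(w₁, …) = θ (v, w₁, …)`. -/
def interior {k : ℕ} (v : V) (θ : V [⋀^Fin (k + 1)]→L[ℝ] ℝ) : V [⋀^Fin k]→L[ℝ] ℝ :=
  { θ.toAlternatingMap.curryLeft v with
    cont := by
      have h : Continuous fun w : Fin k → V => θ (Matrix.vecCons v w) :=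
        θ.cont.comp (continuous_const.matrixVecCons continuous_id)
      exact h }

/-- Insertion of the vectors `a` in the first `k` slots of an alternating `n`-form,
`w ↦ θ (a₁, …, aₖ, w₁, …, wₗ)`, where `k + l = n`. -/
def insertFirst {k l n : ℕ} (h : k + l = n) (a : Fin k → V) (θ : V [⋀^Fin n]→L[ℝ] ℝ) :
    V [⋀^Fin l]→L[ℝ] ℝ where
  toFun w := θ (fun j => Fin.append a w (Fin.cast h.symm j))
  map_update_add' := by
    intro inst w i x y
    subst h
    have key : ∀ z : V, Fin.append a (Function.update w i z) =
        Function.update (Fin.append a w) (Fin.natAdd k i) z := by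
      intro z
      funext j
      refine Fin.addCases (fun j => ?_) (fun j => ?_) j
      · rw [Fin.append_left, Function.update_of_ne, Fin.append_left]
        intro hj
        have := congrArg Fin.val hj
        simp at this
        omega
      · rw [Fin.append_right]
        by_cases hji : j = i
        · subst hji; simp
        · rw [Function.update_of_ne hji, Function.update_of_ne, Fin.append_right]
          simpa using hji
    simp only [Fin.cast_refl, id_eq, key]
    exact θ.map_update_add _ _ _ _
  map_update_smul' := by
    intro inst w i c x
    subst h
    have key : ∀ z : V, Fin.append a (Function.update w i z) =
        Function.update (Fin.append a w) (Fin.natAdd k i) z := by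
      intro z
      funext j
      refine Fin.addCases (fun j => ?_) (fun j => ?_) j
      · rw [Fin.append_left, Function.update_of_ne, Fin.append_left]
        intro hj
        have := congrArg Fin.val hj
        simp at this
        omega
      · rw [Fin.append_right]
        by_cases hji : j = i
        · subst hji; simp
        · rw [Function.update_of_ne hji, Function.update_of_ne, Fin.append_right]
          simpa using hji
    simp only [Fin.cast_refl, id_eq, key]
    exact θ.map_update_smul _ _ _ _
  map_eq_zero_of_eq' := by
    intro w i j hw hij
    subst h
    refine θ.map_eq_zero_of_eq _ (i := Fin.natAdd k i) (j := Fin.natAdd k j) ?_ ?_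
    · simpa using hw
    · simpa using hij
  cont := by
    refine θ.cont.comp (continuous_pi fun j => ?_)
    refine Fin.addCases (motive := fun q => Continuous fun w : Fin l → V => Fin.append a w q)
      (fun i => ?_) (fun i => ?_) (Fin.cast h.symm j)
    · simpa using continuous_const
    · simpa using continuous_apply i

end Algebra

/-! ### Differential forms and vector fields on a manifold of dimension `n` -/

section Forms

/-- `k`-forms on `D` (no regularity required). -/
abbrev Form (n : ℕ) (D : Type*) [TopologicalSpace D]
    [ChartedSpace (EuclideanSpace ℝ (Fin n)) D] (k : ℕ) : Type _ :=
  ∀ x : D, TangentSpace (𝓡 n) x [⋀^Fin k]→L[ℝ] ℝ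

/-- Vector fields on `D` (no regularity required). -/
abbrev VField (n : ℕ) (D : Type*) [TopologicalSpace D]
    [ChartedSpace (EuclideanSpace ℝ (Fin n)) D] : Type _ :=
  ∀ x : D, TangentSpace (𝓡 n) x

variable {n : ℕ} {D : Type*} [TopologicalSpace D] [ChartedSpace (EuclideanSpace ℝ (Fin n)) D]

/-- The coordinate expression of a form in the chart around `x₀`, i.e. its pull-back by the
inverse of that chart. It is meaningful on the target of the chart. -/
def inChart {k : ℕ} (x₀ : D) (θ : Form n D k) (y : EuclideanSpace ℝ (Fin n)) :
    EuclideanSpace ℝ (Fin n) [⋀^Fin k]→L[ℝ] ℝ :=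
  (θ ((extChartAt (𝓡 n) x₀).symm y)).compContinuousLinearMap
    (mfderiv 𝓘(ℝ, EuclideanSpace ℝ (Fin n)) (𝓡 n) (extChartAt (𝓡 n) x₀).symm y)

/-- A form is smooth if all its coordinate expressions are. -/
def IsSmoothForm {k : ℕ} (θ : Form n D k) : Prop :=
  ∀ x₀ : D, ContDiffOn ℝ ∞ (inChart x₀ θ) (extChartAt (𝓡 n) x₀).target

/-- A vector field is smooth if it is a smooth section of the tangent bundle. -/
def IsSmoothVField [IsManifold (𝓡 n) ∞ D] (X : VField n D) : Prop :=
  ContMDiff (𝓡 n) (𝓡 n).tangent ∞ (fun x => (⟨x, X x⟩ : TangentBundle (𝓡 n) D))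

/-- Smooth real functions. -/
def IsSmoothFun (f : D → ℝ) : Prop := ContMDiff (𝓡 n) 𝓘(ℝ, ℝ) ∞ f

/-- The exterior derivative, computed at `x` in the chart around `x`. -/
def extD {k : ℕ} (θ : Form n D k) : Form n D (k + 1) := fun x =>
  (extDeriv (inChart x θ) (extChartAt (𝓡 n) x x)).compContinuousLinearMap
    (mfderiv (𝓡 n) 𝓘(ℝ, EuclideanSpace ℝ (Fin n)) (extChartAt (𝓡 n) x) x)

/-- A function as a `0`-form. -/
def zeroForm (n : ℕ) [ChartedSpace (EuclideanSpace ℝ (Fin n)) D] (f : D → ℝ) : Form n D 0 :=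
  fun x => ContinuousAlternatingMap.constOfIsEmpty ℝ (TangentSpace (𝓡 n) x) (Fin 0) (f x)

/-- The interior product of a vector field with a form. -/
def iprod {k : ℕ} (X : VField n D) (θ : Form n D (k + 1)) : Form n D k :=
  fun x => interior (X x) (θ x)

/-- The Lie derivative of a form of positive degree: `𝓛_X θ = d (X ⌟ θ) + X ⌟ dθ`. -/
def lieD {k : ℕ} (X : VField n D) (θ : Form n D (k + 1)) : Form n D (k + 1) :=
  extD (iprod X θ) + iprod X (extD θ)

/-- The Lie derivative of a function: `𝓛_X f = X ⌟ df`. -/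
def lieFun (X : VField n D) (f : D → ℝ) : D → ℝ :=
  fun x => extD (zeroForm n f) x (fun _ => X x)

/-- The value of a `1`-form on a vector field. -/
def pairing (α : Form n D 1) (X : VField n D) : D → ℝ := fun x => α x (fun _ => X x)

/-- Smooth compactly supported forms. -/
def IsTestForm {k : ℕ} (θ : Form n D k) : Prop :=
  IsSmoothForm θ ∧ ∃ K : Set D, IsCompact K ∧ ∀ x, x ∉ K → θ x = 0

/-- Smooth compactly supported functions. -/
def IsTestFun (n : ℕ) [ChartedSpace (EuclideanSpace ℝ (Fin n)) D] (f : D → ℝ) : Prop :=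
  IsSmoothFun (n := n) f ∧ HasCompactSupport f

end Forms

/-! ### Oriented Riemannian manifolds -/

section Riemannian

variable {n : ℕ} {D : Type*} [TopologicalSpace D] [ChartedSpace (EuclideanSpace ℝ (Fin n)) D]

lemma finiteDimensional_tangentSpace (x : D) : FiniteDimensional ℝ (TangentSpace (𝓡 n) x) :=
  inferInstanceAs (FiniteDimensional ℝ (EuclideanSpace ℝ (Fin n)))

lemma finrank_tangentSpace (x : D) : Module.finrank ℝ (TangentSpace (𝓡 n) x) = n := by
  change Module.finrank ℝ (EuclideanSpace ℝ (Fin n)) = n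
  simp

variable [RiemannianBundle (fun x : D => TangentSpace (𝓡 n) x)]

/-- An orthonormal basis of the tangent space at `x`. The operations defined through it below do
not depend on its choice. -/
def frame (x : D) : OrthonormalBasis (Fin n) ℝ (TangentSpace (𝓡 n) x) :=
  haveI := finiteDimensional_tangentSpace (n := n) x
  (stdOrthonormalBasis ℝ (TangentSpace (𝓡 n) x)).reindex (finCongr (finrank_tangentSpace x))

/-- `dV` is the Riemannian volume form of an orientation of `D`: a smooth form of top degree that
takes the values `±1` on orthonormal bases. The choice of such a `dV` is the choice of an
orientation. -/
def IsRiemannianVolumeForm (dV : Form n D n) : Prop :=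
  IsSmoothForm dV ∧
    ∀ (x : D) (e : OrthonormalBasis (Fin n) ℝ (TangentSpace (𝓡 n) x)), |dV x e| = 1

/-- The Hodge star `⋆ : Λᵏ → Λˡ`, `k + l = n`. With `e` an orthonormal basis,
`⋆θ = ∑_{i₁ < … < iₖ} θ(e_{i₁}, …, e_{iₖ}) dV(e_{i₁}, …, e_{iₖ}, ·)`; the sum below
runs over all multi-indices instead. -/
def hodge (dV : Form n D n) {k l : ℕ} (h : k + l = n) (θ : Form n D k) : Form n D l := fun x =>
  ((k.factorial : ℝ)⁻¹) • ∑ I : Fin k → Fin n,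
    θ x (fun j => frame x (I j)) • insertFirst h (fun j => frame x (I j)) (dV x)

/-- The scalar `⋆θ` of a density (form of top degree) `θ`, so that `θ = (⋆θ) dV`. -/
def scal (dV : Form n D n) (θ : Form n D n) : D → ℝ :=
  fun x => hodge dV (Nat.add_zero n) θ x Fin.elim0

/-- The vector field `α^♯` that is metrically dual to the `1`-form `α`. -/
def sharp (α : Form n D 1) : VField n D :=
  fun x => ∑ i, α x (fun _ => frame x i) • frame x i

/-- The pointwise squared norm of a form,
`|θ|² = ∑_{i₁ < … < iₖ} θ(e_{i₁}, …, e_{iₖ})²`, i.e. `θ ∧ ⋆θ = |θ|² dV`. -/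
def normSq {k : ℕ} (θ : Form n D k) : D → ℝ := fun x =>
  ((k.factorial : ℝ)⁻¹) * ∑ I : Fin k → Fin n, (θ x (fun j => frame x (I j))) ^ 2

/-- The Riemannian measure in the chart around `x₀`, transported to `D`. -/
def chartMeasure [MeasurableSpace D] (dV : Form n D n) (x₀ : D) : Measure D :=
  ((volume.restrict (extChartAt (𝓡 n) x₀).target).withDensity fun y =>
    ENNReal.ofReal |inChart x₀ dV y (EuclideanSpace.basisFun (Fin n) ℝ)|).map
      (extChartAt (𝓡 n) x₀).symm

/-- The Riemannian measure of `D`: the smallest measure that dominates the Riemannian measures of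
all the charts. As these agree on overlaps, it restricts to each of them. -/
def riemMeasure [MeasurableSpace D] (dV : Form n D n) : Measure D := ⨆ x₀, chartMeasure dV x₀

end Riemannian

/-! ### The Lie–Poisson phase space

The dimension is `m + 2`. Densities are forms of top degree. A `1`-form density `𝐌 ⊗ dV` is
represented by the `1`-form `𝐌`. -/

section PhaseSpace

/-- The variables of Hall MHD: total momentum `M` (a `1`-form density), mass density `ρ`,
entropy per mass `s`, magnetic momentum `μ` (a `1`-form density) and electron charge density
`nt` (`ñ`). -/
structure State (m : ℕ) (D : Type*) [TopologicalSpace D]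
    [ChartedSpace (EuclideanSpace ℝ (Fin (m + 2))) D] where
  M : Form (m + 2) D 1
  ρ : Form (m + 2) D (m + 2)
  s : D → ℝ
  μ : Form (m + 2) D 1
  nt : Form (m + 2) D (m + 2)

/-- The dual variables: vector fields dual to `1`-form densities, functions dual to densities
and a density dual to the function `s`. -/
structure DualState (m : ℕ) (D : Type*) [TopologicalSpace D]
    [ChartedSpace (EuclideanSpace ℝ (Fin (m + 2))) D] where
  M : VField (m + 2) D
  ρ : D → ℝ
  s : Form (m + 2) D (m + 2)
  μ : VField (m + 2) D
  nt : D → ℝ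

variable {m : ℕ} {D : Type*} [TopologicalSpace D]
  [ChartedSpace (EuclideanSpace ℝ (Fin (m + 2))) D]
  [RiemannianBundle (fun x : D => TangentSpace (𝓡 (m + 2)) x)]

/-- Smooth states for which the divisions by `ρ` and by `ñ` make sense. -/
structure State.Admissible (dV : Form (m + 2) D (m + 2)) (Y : State m D) : Prop where
  smooth_M : IsSmoothForm Y.M
  smooth_ρ : IsSmoothForm Y.ρ
  smooth_s : IsSmoothFun (n := m + 2) Y.s
  smooth_μ : IsSmoothForm Y.μ
  smooth_nt : IsSmoothForm Y.nt
  ρ_ne : ∀ x, scal dV Y.ρ x ≠ 0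
  nt_ne : ∀ x, scal dV Y.nt x ≠ 0

/-- `Z` is the (smooth) variational derivative at `Y` of the functional `∫_D F(Y) dV` with density
`F`:
the derivative in the direction of a compactly supported variation is the duality pairing with
`Z`. The increment of the functional is written as the integral of the compactly supported
increment of the density, so that nothing is assumed on the convergence of `∫_D F(Y) dV`. -/
structure IsVarDeriv [IsManifold (𝓡 (m + 2)) ∞ D] [MeasurableSpace D]
    (dV : Form (m + 2) D (m + 2)) (F : State m D → D → ℝ) (Y : State m D)
    (Z : DualState m D) : Prop where
  smooth_M : IsSmoothVField Z.M
  smooth_ρ : IsSmoothFun (n := m + 2) Z.ρ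
  smooth_s : IsSmoothForm Z.s
  smooth_μ : IsSmoothVField Z.μ
  smooth_nt : IsSmoothFun (n := m + 2) Z.nt
  deriv_M : ∀ ν : Form (m + 2) D 1, IsTestForm ν →
    HasDerivAt (fun ε : ℝ => ∫ x, (F { Y with M := Y.M + ε • ν } x - F Y x) ∂(riemMeasure dV))
      (∫ x, pairing ν Z.M x ∂(riemMeasure dV)) 0
  deriv_ρ : ∀ ν : Form (m + 2) D (m + 2), IsTestForm ν →
    HasDerivAt (fun ε : ℝ => ∫ x, (F { Y with ρ := Y.ρ + ε • ν } x - F Y x) ∂(riemMeasure dV))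
      (∫ x, scal dV ν x * Z.ρ x ∂(riemMeasure dV)) 0
  deriv_s : ∀ f : D → ℝ, IsTestFun (m + 2) f →
    HasDerivAt (fun ε : ℝ => ∫ x, (F { Y with s := Y.s + ε • f } x - F Y x) ∂(riemMeasure dV))
      (∫ x, f x * scal dV Z.s x ∂(riemMeasure dV)) 0
  deriv_μ : ∀ ν : Form (m + 2) D 1, IsTestForm ν →
    HasDerivAt (fun ε : ℝ => ∫ x, (F { Y with μ := Y.μ + ε • ν } x - F Y x) ∂(riemMeasure dV))
      (∫ x, pairing ν Z.μ x ∂(riemMeasure dV)) 0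
  deriv_nt : ∀ ν : Form (m + 2) D (m + 2), IsTestForm ν →
    HasDerivAt (fun ε : ℝ => ∫ x, (F { Y with nt := Y.nt + ε • ν } x - F Y x) ∂(riemMeasure dV))
      (∫ x, scal dV ν x * Z.nt x ∂(riemMeasure dV)) 0

/-- `ad*_X` on `1`-form densities, which is their Lie derivative:
`𝓛_X (α ⊗ dV) = 𝓛_X α ⊗ dV + α ⊗ 𝓛_X dV`. -/
def adStar (dV : Form (m + 2) D (m + 2)) (X : VField (m + 2) D) (α : Form (m + 2) D 1) :
    Form (m + 2) D 1 :=
  lieD X α + fun x => scal dV (lieD X dV) x • α x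

/-- `f ⋄ θ = (⋆θ) df ⊗ dV` for a function `f` and a density `θ`, so that
`∫ f 𝓛_X θ = - ⟨f ⋄ θ, X⟩` for compactly supported `X`. -/
def diamondDen (dV : Form (m + 2) D (m + 2)) (f : D → ℝ) (θ : Form (m + 2) D (m + 2)) :
    Form (m + 2) D 1 :=
  fun x => scal dV θ x • extD (zeroForm (m + 2) f) x

/-- `θ ⋄ f = - (⋆θ) df ⊗ dV` for a density `θ` and a function `f`, so that
`∫ (𝓛_X f) θ = - ⟨θ ⋄ f, X⟩`. -/
def diamondFun (dV : Form (m + 2) D (m + 2)) (θ : Form (m + 2) D (m + 2)) (f : D → ℝ) :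
    Form (m + 2) D 1 :=
  fun x => -(scal dV θ x) • extD (zeroForm (m + 2) f) x

/-- The Lie–Poisson operator at the state `Y`, applied to the vector `Z` of variational
derivatives. -/
def liePoisson (dV : Form (m + 2) D (m + 2)) (Y : State m D) (Z : DualState m D) :
    State m D where
  M := adStar dV Z.M Y.M + diamondDen dV Z.ρ Y.ρ + diamondFun dV Z.s Y.s
  ρ := lieD Z.M Y.ρ
  s := lieFun Z.M Y.s
  μ := adStar dV Z.μ Y.μ + diamondDen dV Z.nt Y.nt
  nt := lieD Z.μ Y.nt

/-- The `1`-form `μ/ñ`, where `ñ = (⋆ñ) dV`. -/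
def magForm (dV : Form (m + 2) D (m + 2)) (Y : State m D) : Form (m + 2) D 1 :=
  fun x => (scal dV Y.nt x)⁻¹ • Y.μ x

/-- The fluid momentum `M - (aρ/ñ) μ`. -/
def fluidMomentum (dV : Form (m + 2) D (m + 2)) (a : ℝ) (Y : State m D) : Form (m + 2) D 1 :=
  fun x => Y.M x - (a * scal dV Y.ρ x / scal dV Y.nt x) • Y.μ x

/-- The density, with respect to `dV`, of the Hamiltonian of ideal compressible Hall MHD with
charge to mass ratio `a`, Hall parameter `R` and internal energy per mass `e(ρ, s)`. -/
def hamiltonian (dV : Form (m + 2) D (m + 2)) (a R : ℝ) (e : ℝ → ℝ → ℝ) (Y : State m D) :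
    D → ℝ := fun x =>
  normSq (fluidMomentum dV a Y) x / (2 * scal dV Y.ρ x)
    + scal dV Y.ρ x * e (scal dV Y.ρ x) (Y.s x)
    + R ^ 2 / 2 * normSq (extD (magForm dV Y)) x

/-- The density of the transport noise Hamiltonian `⟨M - (aρ/ñ) μ, ξ⟩`. -/
def fluidNoise (dV : Form (m + 2) D (m + 2)) (a : ℝ) (ξ : VField (m + 2) D) (Y : State m D) :
    D → ℝ :=
  pairing (fluidMomentum dV a Y) ξ

/-- The codifferential `δ = ⋆d⋆` on `2`-forms. -/
def codiff (dV : Form (m + 2) D (m + 2)) (σ : Form (m + 2) D 2) : Form (m + 2) D 1 :=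
  hodge dV (k := m + 1) (l := 1) rfl (extD (hodge dV (k := 2) (l := m) (Nat.add_comm 2 m) σ))

/-- The density of the magnetic noise Hamiltonian `∫ (δσ)^♯ ⌟ (μ/ñ) dV`. -/
def magNoise (dV : Form (m + 2) D (m + 2)) (σ : Form (m + 2) D 2) (Y : State m D) : D → ℝ :=
  pairing (magForm dV Y) (sharp (codiff dV σ))

end PhaseSpace

/-! ### Stratonovich equations -/

section Stochastic

variable {Ω : Type*} [MeasurableSpace Ω]

/-- A family of independent standard Brownian motions, all of them Brownian motions with respect
to the filtration `𝓕`. -/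
structure IsBrownianFamily {ι : Type*} (𝓕 : Filtration ℝ≥0 ‹MeasurableSpace Ω›) (P : Measure Ω)
    (W : ι → ℝ≥0 → Ω → ℝ) : Prop where
  brownian : ∀ i, IsBrownianReal (W i) P
  adapted : ∀ i t, Measurable[𝓕 t] (W i t)
  indep_past : ∀ i s t, s ≤ t →
    Indep (MeasurableSpace.comap (W i t - W i s) inferInstance) (𝓕 s) P
  indep : iIndepFun (fun i o t => W i t o) P

/-- `Z t = ∫₀ᵗ X ∘ dW` for all `t`: along every sequence of partitions of `[0, t]` with mesh
tending to `0`, the sums `∑ₖ (X(tₖ) + X(tₖ₊₁))/2 · (W(tₖ₊₁) - W(tₖ))` converge to `Z t` in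
probability. -/
def IsStratonovichIntegral (P : Measure Ω) (X W Z : ℝ≥0 → Ω → ℝ) : Prop :=
  ∀ (t : ℝ≥0) (N : ℕ → ℕ) (p : ℕ → ℕ → ℝ≥0),
    (∀ j, Monotone (p j) ∧ p j 0 = 0 ∧ p j (N j) = t) →
    (∀ δ : ℝ, 0 < δ → ∀ᶠ j in atTop, ∀ k < N j, ((p j (k + 1) : ℝ) - p j k) < δ) →
    TendstoInMeasure P
      (fun j o => ∑ k ∈ Finset.range (N j),
        (X (p j k) o + X (p j (k + 1)) o) / 2 * (W (p j (k + 1)) o - W (p j k) o))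
      atTop (Z t)

/-- `S t = ∑ᵢ ∫₀^{t ∧ τ} c i ∘ dW i` for all `t`, the (at most countable) sum being unconditionally
convergent in probability. -/
def IsStratonovichSum {ι : Type*} (P : Measure Ω) (τ : Ω → WithTop ℝ≥0)
    (c W : ι → ℝ≥0 → Ω → ℝ) (S : ℝ≥0 → Ω → ℝ) : Prop :=
  ∃ Z : ι → ℝ≥0 → Ω → ℝ,
    (∀ i, IsStratonovichIntegral P (stoppedProcess (c i) τ) (stoppedProcess (W i) τ) (Z i)) ∧
    ∀ t, TendstoInMeasure P (fun (A : Finset ι) o => ∑ i ∈ A, Z i t o) atTop (S t)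

/-- The time interval `[0, t ∧ τ(o)]`. -/
def timeSet (τ : Ω → WithTop ℝ≥0) (t : ℝ≥0) (o : Ω) : Set ℝ :=
  {r : ℝ | 0 ≤ r ∧ r ≤ t ∧ ((r.toNNReal : ℝ≥0) : WithTop ℝ≥0) ≤ τ o}

/-- The real process `y` is a solution, up to the time `τ`, of
`dy = b dt + ∑ᵢ c i ∘ dW i + ∑ⱼ g j ∘ dB j`. -/
structure SolvesSDE {ι κ : Type*} (𝓕 : Filtration ℝ≥0 ‹MeasurableSpace Ω›) (P : Measure Ω)
    (τ : Ω → WithTop ℝ≥0) (W : ι → ℝ≥0 → Ω → ℝ) (B : κ → ℝ≥0 → Ω → ℝ)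
    (y b : ℝ≥0 → Ω → ℝ) (c : ι → ℝ≥0 → Ω → ℝ) (g : κ → ℝ≥0 → Ω → ℝ) : Prop where
  adapted : ∀ t, Measurable[𝓕 t] (stoppedProcess y τ t)
  integrable : ∀ᵐ o ∂P, ∀ t, IntegrableOn (fun r : ℝ => b r.toNNReal o) (timeSet τ t o)
  eqn : ∃ SW SB : ℝ≥0 → Ω → ℝ,
    IsStratonovichSum P τ c W SW ∧ IsStratonovichSum P τ g B SB ∧
    ∀ t, ∀ᵐ o ∂P, stoppedProcess y τ t o =
      y 0 o + (∫ r in timeSet τ t o, b r.toNNReal o) + SW t o + SB t o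

variable {m : ℕ} {D : Type*} [TopologicalSpace D]
  [ChartedSpace (EuclideanSpace ℝ (Fin (m + 2))) D] [IsManifold (𝓡 (m + 2)) ∞ D]
  [RiemannianBundle (fun x : D => TangentSpace (𝓡 (m + 2)) x)] [MeasurableSpace D]

/-- `Y` is a (smooth, pathwise continuous) solution up to the time `τ` of the stochastic
Lie–Poisson equations
`dY = - 𝕁(Y) (δH/δY dt + ∑ᵢ δHᵢ/δY ∘ dWⁱ + ∑ⱼ δhⱼ/δY ∘ dBʲ)`, where `𝕁(Y)` is the Lie–Poisson
operator and `H`, `Hᵢ`, `hⱼ` are given by their densities. -/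
structure SolvesStochasticLiePoisson {ι κ : Type*} (dV : Form (m + 2) D (m + 2))
    (𝓕 : Filtration ℝ≥0 ‹MeasurableSpace Ω›) (P : Measure Ω) (τ : Ω → WithTop ℝ≥0)
    (W : ι → ℝ≥0 → Ω → ℝ) (B : κ → ℝ≥0 → Ω → ℝ)
    (H : State m D → D → ℝ) (Hi : ι → State m D → D → ℝ) (hi : κ → State m D → D → ℝ)
    (Y : ℝ≥0 → Ω → State m D) : Prop where
  admissible : ∀ᵐ o ∂P, ∀ t : ℝ≥0, (t : WithTop ℝ≥0) ≤ τ o → (Y t o).Admissible dV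
  continuous : ∀ᵐ o ∂P, ∀ x : D,
    (∀ v, Continuous fun t => (stoppedProcess Y τ t o).M x v) ∧
    (∀ v, Continuous fun t => (stoppedProcess Y τ t o).ρ x v) ∧
    (Continuous fun t => (stoppedProcess Y τ t o).s x) ∧
    (∀ v, Continuous fun t => (stoppedProcess Y τ t o).μ x v) ∧
    (∀ v, Continuous fun t => (stoppedProcess Y τ t o).nt x v)
  eqn : ∃ (U : ℝ≥0 → Ω → DualState m D) (Ui : ι → ℝ≥0 → Ω → DualState m D)
      (ui : κ → ℝ≥0 → Ω → DualState m D),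
    (∀ᵐ o ∂P, ∀ t : ℝ≥0, (t : WithTop ℝ≥0) ≤ τ o →
      IsVarDeriv dV H (Y t o) (U t o) ∧
      (∀ i, IsVarDeriv dV (Hi i) (Y t o) (Ui i t o)) ∧
      (∀ j, IsVarDeriv dV (hi j) (Y t o) (ui j t o))) ∧
    (∀ x v, SolvesSDE 𝓕 P τ W B (fun t o => (Y t o).M x v)
      (fun t o => -(liePoisson dV (Y t o) (U t o)).M x v)
      (fun i t o => -(liePoisson dV (Y t o) (Ui i t o)).M x v)
      (fun j t o => -(liePoisson dV (Y t o) (ui j t o)).M x v)) ∧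
    (∀ x v, SolvesSDE 𝓕 P τ W B (fun t o => (Y t o).ρ x v)
      (fun t o => -(liePoisson dV (Y t o) (U t o)).ρ x v)
      (fun i t o => -(liePoisson dV (Y t o) (Ui i t o)).ρ x v)
      (fun j t o => -(liePoisson dV (Y t o) (ui j t o)).ρ x v)) ∧
    (∀ x, SolvesSDE 𝓕 P τ W B (fun t o => (Y t o).s x)
      (fun t o => -(liePoisson dV (Y t o) (U t o)).s x)
      (fun i t o => -(liePoisson dV (Y t o) (Ui i t o)).s x)
      (fun j t o => -(liePoisson dV (Y t o) (ui j t o)).s x)) ∧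
    (∀ x v, SolvesSDE 𝓕 P τ W B (fun t o => (Y t o).μ x v)
      (fun t o => -(liePoisson dV (Y t o) (U t o)).μ x v)
      (fun i t o => -(liePoisson dV (Y t o) (Ui i t o)).μ x v)
      (fun j t o => -(liePoisson dV (Y t o) (ui j t o)).μ x v)) ∧
    (∀ x v, SolvesSDE 𝓕 P τ W B (fun t o => (Y t o).nt x v)
      (fun t o => -(liePoisson dV (Y t o) (U t o)).nt x v)
      (fun i t o => -(liePoisson dV (Y t o) (Ui i t o)).nt x v)
      (fun j t o => -(liePoisson dV (Y t o) (ui j t o)).nt x v))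

end Stochastic

end HallMHD

end

open HallMHD

set_option linter.unusedSectionVars false

/-! The mechanism is a gauge symmetry. The Hamiltonian and the transport noise depend on `M` and `μ`
only through the fluid momentum `M - (aρ/ñ)μ` and the exterior derivative of `μ/ñ`. Adding `ε ñ df`
to `μ` shifts `μ/ñ` by the exact form `ε df`, which `d` kills, and shifts the fluid momentum exactly
as adding `-ε aρ df` to `M` does. Differentiating at `ε = 0` gives `∫ df(ñ X̃) = -∫ df(aρ X)` for
every test function `f`, where `X`, `X̃` are the variational derivatives in `M`, `μ` and densities
stand for their coefficients. So `aρ X + ñ X̃` is weakly divergence-free. As everything is smooth,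
`d(X ⌟ aρ + X̃ ⌟ ñ) = 0`, which by Cartan's formula in top degree is `a 𝓛_X ρ + 𝓛_X̃ ñ = 0`
(`lieD_add_eq_zero_of_invariant`, resting on `extD_iprod_eq_of_integral_eq`).

The magnetic noise lacks this pointwise invariance. It does not involve `M`, so `aρ X` alone is
weakly divergence-free, while `ñ X̃` has the weak divergence of `(δσ)^♯`. The flux form of that
field is `± d⋆σ`, hence closed (`iprod_sharp_codiff`, `lieD_add_magNoise`).

Thus in the equation for `aρ + ñ` the drift and every noise coefficient vanish up to `τ`. The
approximating Stratonovich sums then cancel term by term, so `SolvesSDE.linear_const` needs only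
almost sure uniqueness of limits in probability. This yields the claim almost surely at each fixed
point and time; countable dense sets, continuity in time and smoothness in space remove the
dependence of the null set on them. -/

namespace HallMHD

/-! ### Exterior calculus in charts and its independence of the chart. -/

section ChartCalculus

variable {n : ℕ} {D : Type*} [TopologicalSpace D] [ChartedSpace (EuclideanSpace ℝ (Fin n)) D]

lemma inChart_add {k : ℕ} (x₀ : D) (θ η : Form n D k) :
    inChart x₀ (θ + η) = inChart x₀ θ + inChart x₀ η := rfl

lemma inChart_zeroForm (x₀ : D) (f : D → ℝ) :
    inChart x₀ (zeroForm n f) = fun y => ContinuousAlternatingMap.constOfIsEmpty ℝ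
      (EuclideanSpace ℝ (Fin n)) (Fin 0) (f ((extChartAt (𝓡 n) x₀).symm y)) := rfl

variable [IsManifold (𝓡 n) ∞ D]

lemma two_le_infty : (2 : WithTop ℕ∞) ≤ ((⊤ : ℕ∞) : WithTop ℕ∞) :=
  WithTop.coe_le_coe.2 (le_top : (2 : ℕ∞) ≤ ⊤)

lemma isManifold_one : IsManifold (𝓡 n) 1 D := IsManifold.of_le (n := ∞) (by norm_num)

lemma mdifferentiableAt_symm {x₀ : D} {y : EuclideanSpace ℝ (Fin n)}
    (hy : y ∈ (extChartAt (𝓡 n) x₀).target) :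
    MDifferentiableAt 𝓘(ℝ, EuclideanSpace ℝ (Fin n)) (𝓡 n) (extChartAt (𝓡 n) x₀).symm y := by
  have := isManifold_one (n := n) (D := D)
  have := mdifferentiableWithinAt_extChartAt_symm (I := 𝓡 n) hy
  simpa [mdifferentiableWithinAt_univ] using this

lemma mdifferentiableAt_chart {x₀ x : D} (hx : x ∈ (extChartAt (𝓡 n) x₀).source) :
    MDifferentiableAt (𝓡 n) 𝓘(ℝ, EuclideanSpace ℝ (Fin n)) (extChartAt (𝓡 n) x₀) x := by
  have := isManifold_one (n := n) (D := D)
  exact mdifferentiableAt_extChartAt (by simpa using hx)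

lemma mfderiv_chart_comp_symm {x₀ : D} {y : EuclideanSpace ℝ (Fin n)}
    (hy : y ∈ (extChartAt (𝓡 n) x₀).target) :
    (mfderiv (𝓡 n) 𝓘(ℝ, EuclideanSpace ℝ (Fin n)) (extChartAt (𝓡 n) x₀)
      ((extChartAt (𝓡 n) x₀).symm y)) ∘L
    (mfderiv 𝓘(ℝ, EuclideanSpace ℝ (Fin n)) (𝓡 n) (extChartAt (𝓡 n) x₀).symm y) =
      ContinuousLinearMap.id _ _ := by
  have := isManifold_one (n := n) (D := D)
  have := mfderiv_extChartAt_comp_mfderivWithin_extChartAt_symm (I := 𝓡 n) hy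
  simpa [mfderivWithin_univ] using this

lemma mfderiv_symm_comp_chart {x₀ x : D} (hx : x ∈ (extChartAt (𝓡 n) x₀).source) :
    (mfderiv 𝓘(ℝ, EuclideanSpace ℝ (Fin n)) (𝓡 n) (extChartAt (𝓡 n) x₀).symm
      (extChartAt (𝓡 n) x₀ x)) ∘L
    (mfderiv (𝓡 n) 𝓘(ℝ, EuclideanSpace ℝ (Fin n)) (extChartAt (𝓡 n) x₀) x) =
      ContinuousLinearMap.id ℝ (TangentSpace (𝓡 n) x) := by
  have := isManifold_one (n := n) (D := D)
  have := mfderivWithin_extChartAt_symm_comp_mfderiv_extChartAt' (I := 𝓡 n) hx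
  simpa [mfderivWithin_univ] using this

/-- The transition map from the chart at `x₀` to the chart at `x₁`. -/
noncomputable def transition (x₀ x₁ : D) (y : EuclideanSpace ℝ (Fin n)) : EuclideanSpace ℝ (Fin n) :=
  extChartAt (𝓡 n) x₁ ((extChartAt (𝓡 n) x₀).symm y)

lemma contDiffAt_transition {x₀ x₁ : D} {y : EuclideanSpace ℝ (Fin n)}
    (hy : y ∈ (extChartAt (𝓡 n) x₀).target)
    (hy' : (extChartAt (𝓡 n) x₀).symm y ∈ (extChartAt (𝓡 n) x₁).source) :
    ContDiffAt ℝ ∞ (transition x₀ x₁ : EuclideanSpace ℝ (Fin n) → _) y := by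
  have := contDiffWithinAt_ext_coord_change (I := 𝓡 n) (n := ∞) x₁ x₀ (y := y)
    (by rw [PartialEquiv.trans_source]; exact ⟨hy, hy'⟩)
  rwa [modelWithCornersSelf_coe, Set.range_id, contDiffWithinAt_univ] at this

lemma fderiv_transition {x₀ x₁ : D} {y : EuclideanSpace ℝ (Fin n)}
    (hy : y ∈ (extChartAt (𝓡 n) x₀).target)
    (hy' : (extChartAt (𝓡 n) x₀).symm y ∈ (extChartAt (𝓡 n) x₁).source) :
    fderiv ℝ (transition x₀ x₁ : EuclideanSpace ℝ (Fin n) → _) y =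
      (mfderiv (𝓡 n) 𝓘(ℝ, EuclideanSpace ℝ (Fin n)) (extChartAt (𝓡 n) x₁)
        ((extChartAt (𝓡 n) x₀).symm y)) ∘L
      (mfderiv 𝓘(ℝ, EuclideanSpace ℝ (Fin n)) (𝓡 n) (extChartAt (𝓡 n) x₀).symm y) := by
  rw [← mfderiv_eq_fderiv]
  exact mfderiv_comp y (mdifferentiableAt_chart hy') (mdifferentiableAt_symm hy)

lemma eventually_mem_overlap {x₀ x₁ : D} {y : EuclideanSpace ℝ (Fin n)}
    (hy : y ∈ (extChartAt (𝓡 n) x₀).target)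
    (hy' : (extChartAt (𝓡 n) x₀).symm y ∈ (extChartAt (𝓡 n) x₁).source) :
    ∀ᶠ z in 𝓝 y, z ∈ (extChartAt (𝓡 n) x₀).target ∧
      (extChartAt (𝓡 n) x₀).symm z ∈ (extChartAt (𝓡 n) x₁).source :=
  ((isOpen_extChartAt_target x₀).eventually_mem hy).and
    ((continuousAt_extChartAt_symm'' hy).eventually
      ((isOpen_extChartAt_source x₁).eventually_mem hy'))

lemma form_eq_pullback {k : ℕ} {x₀ x : D} (θ : Form n D k)
    (hx : x ∈ (extChartAt (𝓡 n) x₀).source) :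
    θ x = (inChart x₀ θ (extChartAt (𝓡 n) x₀ x)).compContinuousLinearMap
      (mfderiv (𝓡 n) 𝓘(ℝ, EuclideanSpace ℝ (Fin n)) (extChartAt (𝓡 n) x₀) x) := by
  -- Going to the chart and back returns `x` only up to a propositional equality, and the fibre
  -- depends on the point. Generalizing the point to `x'` lets the equality be eliminated.
  have key : ∀ x' : D, x' = x → ∀ (A : EuclideanSpace ℝ (Fin n) →L[ℝ] TangentSpace (𝓡 n) x')
      (C : TangentSpace (𝓡 n) x →L[ℝ] EuclideanSpace ℝ (Fin n)),
      A ∘L C = ContinuousLinearMap.id ℝ (TangentSpace (𝓡 n) x) →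
      θ x = ((θ x').compContinuousLinearMap A).compContinuousLinearMap C := by
    rintro x' rfl A C h
    ext v
    simp only [ContinuousAlternatingMap.compContinuousLinearMap_apply]
    congr 1
    funext i
    exact (congrArg (fun T => T (v i)) h).symm
  exact key _ ((extChartAt (𝓡 n) x₀).left_inv hx) _ _ (mfderiv_symm_comp_chart hx)

lemma inChart_change {k : ℕ} {x₀ x₁ : D} {y : EuclideanSpace ℝ (Fin n)} (θ : Form n D k)
    (hy : y ∈ (extChartAt (𝓡 n) x₀).target)
    (hy' : (extChartAt (𝓡 n) x₀).symm y ∈ (extChartAt (𝓡 n) x₁).source) :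
    inChart x₀ θ y = (inChart x₁ θ (transition x₀ x₁ y)).compContinuousLinearMap
      (fderiv ℝ (transition x₀ x₁) y) := by
  rw [fderiv_transition hy hy']
  conv_lhs => unfold inChart
  rw [form_eq_pullback θ hy']
  rfl

lemma IsSmoothForm.contDiffAt {k : ℕ} {θ : Form n D k} (hθ : IsSmoothForm θ) {x₀ : D}
    {y : EuclideanSpace ℝ (Fin n)} (hy : y ∈ (extChartAt (𝓡 n) x₀).target) :
    ContDiffAt ℝ ∞ (inChart x₀ θ) y :=
  (hθ x₀).contDiffAt ((isOpen_extChartAt_target x₀).mem_nhds hy)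

/-- `extD` uses a different chart at each point. Naturality of the exterior derivative under the
transition map shows that one fixed chart computes it throughout its domain, so it can be
differentiated again. -/
lemma inChart_extD {k : ℕ} {θ : Form n D k} {x₀ : D} {y : EuclideanSpace ℝ (Fin n)}
    (hy : y ∈ (extChartAt (𝓡 n) x₀).target)
    (hθ : DifferentiableAt ℝ (inChart ((extChartAt (𝓡 n) x₀).symm y) θ)
      (extChartAt (𝓡 n) ((extChartAt (𝓡 n) x₀).symm y) ((extChartAt (𝓡 n) x₀).symm y))) :
    inChart x₀ (extD θ) y = extDeriv (inChart x₀ θ) y := by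
  set x := (extChartAt (𝓡 n) x₀).symm y with hx
  have hy' : x ∈ (extChartAt (𝓡 n) x).source := mem_extChartAt_source x
  have h1 : inChart x₀ θ =ᶠ[𝓝 y] fun z =>
      (inChart x θ (transition x₀ x z)).compContinuousLinearMap
      (fderiv ℝ (transition x₀ x) z) := by
    filter_upwards [eventually_mem_overlap hy hy'] with z hz
    exact inChart_change θ hz.1 hz.2
  have h2 : extDeriv (fun z => (inChart x θ (transition x₀ x z)).compContinuousLinearMap
      (fderiv ℝ (transition x₀ x) z)) y = (extDeriv (inChart x θ)
        (transition x₀ x y)).compContinuousLinearMap (fderiv ℝ (transition x₀ x) y) :=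
    extDeriv_pullback hθ (contDiffAt_transition hy hy') (by simpa using two_le_infty)
  rw [h1.extDeriv_eq, h2, fderiv_transition hy hy']
  rfl

lemma IsSmoothForm.inChart_extD {k : ℕ} {θ : Form n D k} (hθ : IsSmoothForm θ) {x₀ : D}
    {y : EuclideanSpace ℝ (Fin n)} (hy : y ∈ (extChartAt (𝓡 n) x₀).target) :
    inChart x₀ (extD θ) y = extDeriv (inChart x₀ θ) y :=
  HallMHD.inChart_extD hy ((hθ.contDiffAt (mem_extChartAt_target _)).differentiableAt (by simp))

lemma IsSmoothForm.extD {k : ℕ} {θ : Form n D k} (hθ : IsSmoothForm θ) :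
    IsSmoothForm (extD θ) := by
  intro x₀
  have h : ContDiffOn ℝ ∞ (extDeriv (inChart x₀ θ)) (extChartAt (𝓡 n) x₀).target := by
    have h1 : ContDiffOn ℝ ∞ (fderiv ℝ (inChart x₀ θ)) (extChartAt (𝓡 n) x₀).target :=
      (hθ x₀).fderiv_of_isOpen (isOpen_extChartAt_target x₀) (by simp)
    exact (ContinuousAlternatingMap.alternatizeUncurryFinCLM ℝ _ _).contDiff.comp_contDiffOn h1
  exact h.congr fun y hy => hθ.inChart_extD hy

lemma form_eq_of_inChart_eq {k : ℕ} {x₀ x : D} {θ η : Form n D k}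
    (hx : x ∈ (extChartAt (𝓡 n) x₀).source)
    (h : inChart x₀ θ (extChartAt (𝓡 n) x₀ x) = inChart x₀ η (extChartAt (𝓡 n) x₀ x)) :
    θ x = η x := by
  rw [form_eq_pullback θ hx, form_eq_pullback η hx, h]

lemma extD_extD {k : ℕ} {θ : Form n D k} (hθ : IsSmoothForm θ) : extD (extD θ) = 0 := by
  funext x
  have hx := mem_extChartAt_source (I := 𝓡 n) x
  refine form_eq_of_inChart_eq hx ?_
  have hy := mem_extChartAt_target (I := 𝓡 n) x
  rw [hθ.extD.inChart_extD hy]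
  have : inChart x (extD θ) =ᶠ[𝓝 (extChartAt (𝓡 n) x x)] extDeriv (inChart x θ) := by
    filter_upwards [(isOpen_extChartAt_target x).mem_nhds hy] with z hz
    exact hθ.inChart_extD hz
  rw [this.extDeriv_eq, extDeriv_extDeriv_apply (hθ.contDiffAt hy) (by simpa using two_le_infty)]
  rfl

lemma extD_add {k : ℕ} {θ η : Form n D k} (hθ : IsSmoothForm θ) (hη : IsSmoothForm η) :
    extD (θ + η) = extD θ + extD η := by
  funext x
  have hy := mem_extChartAt_target (I := 𝓡 n) x
  unfold extD
  rw [inChart_add, extDeriv_add ((hθ.contDiffAt hy).differentiableAt (by simp))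
    ((hη.contDiffAt hy).differentiableAt (by simp))]
  rfl

lemma extD_smul {k : ℕ} (c : ℝ) (θ : Form n D k) : extD (c • θ) = c • extD θ := by
  funext x
  have : inChart x (c • θ) = c • inChart x θ := rfl
  unfold extD
  rw [this, extDeriv_smul]
  rfl

lemma IsSmoothForm.add {k : ℕ} {θ η : Form n D k} (hθ : IsSmoothForm θ) (hη : IsSmoothForm η) :
    IsSmoothForm (θ + η) := fun x₀ => (hθ x₀).add (hη x₀)

lemma IsSmoothForm.const_smul {k : ℕ} (c : ℝ) {θ : Form n D k} (hθ : IsSmoothForm θ) :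
    IsSmoothForm (c • θ) := fun x₀ => (hθ x₀).const_smul c

/-- The coordinate expression of a smooth function is smooth. -/
lemma IsSmoothFun.contDiffOn {f : D → ℝ} (hf : IsSmoothFun (n := n) f) (x₀ : D) :
    ContDiffOn ℝ ∞ (fun y => f ((extChartAt (𝓡 n) x₀).symm y)) (extChartAt (𝓡 n) x₀).target := by
  rw [← contMDiffOn_iff_contDiffOn]
  exact hf.comp_contMDiffOn (contMDiffOn_extChartAt_symm x₀)

lemma isSmoothFun_of_contDiffOn {f : D → ℝ} (hf : ∀ x₀ : D,
    ContDiffOn ℝ ∞ (fun y => f ((extChartAt (𝓡 n) x₀).symm y)) (extChartAt (𝓡 n) x₀).target) :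
    IsSmoothFun (n := n) f := by
  intro x
  have h1 := contMDiffOn_iff_contDiffOn.2 (hf x)
  have h2 := h1.comp (contMDiffOn_extChartAt (I := 𝓡 n) (n := ∞) (x := x)) (fun z hz => by
    exact (extChartAt (𝓡 n) x).map_source (by simpa using hz))
  have h3 : ContMDiffOn (𝓡 n) 𝓘(ℝ, ℝ) ∞ f (chartAt (EuclideanSpace ℝ (Fin n)) x).source :=
    h2.congr fun z hz => by
      simp only [Function.comp]
      rw [(extChartAt (𝓡 n) x).left_inv (by simpa using hz)]
  exact h3.contMDiffAt ((chartAt _ x).open_source.mem_nhds (mem_chart_source _ x))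

lemma IsSmoothForm.fun_smul {k : ℕ} {f : D → ℝ} {θ : Form n D k} (hf : IsSmoothFun (n := n) f)
    (hθ : IsSmoothForm θ) : IsSmoothForm (fun x => f x • θ x) :=
  fun x₀ => (hf.contDiffOn x₀).smul (hθ x₀)

lemma IsSmoothFun.zeroForm {f : D → ℝ} (hf : IsSmoothFun (n := n) f) :
    IsSmoothForm (zeroForm n f) := fun x₀ =>
  (ContinuousAlternatingMap.constOfIsEmptyLIE ℝ (EuclideanSpace ℝ (Fin n)) ℝ
    (Fin 0)).contDiff.comp_contDiffOn (hf.contDiffOn x₀)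

lemma IsSmoothFun.inChart_extD_zeroForm {f : D → ℝ} (hf : IsSmoothFun (n := n) f) {x₀ : D}
    {y : EuclideanSpace ℝ (Fin n)} (hy : y ∈ (extChartAt (𝓡 n) x₀).target) :
    inChart x₀ (HallMHD.extD (HallMHD.zeroForm n f)) y =
      ContinuousAlternatingMap.ofSubsingleton _ _ _ (0 : Fin 1)
        (fderiv ℝ (fun y => f ((extChartAt (𝓡 n) x₀).symm y)) y) := by
  rw [hf.zeroForm.inChart_extD hy, inChart_zeroForm, extDeriv_constOfIsEmpty]

end ChartCalculus

/-! ### Linear algebra of forms of degree `n` and `n - 1` in dimension `n`. -/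

section TopDegree

variable {V : Type*} [AddCommGroup V] [Module ℝ V] [TopologicalSpace V]

lemma interior_apply {k : ℕ} (v : V) (θ : V [⋀^Fin (k + 1)]→L[ℝ] ℝ) (u : Fin k → V) :
    interior v θ u = θ (Matrix.vecCons v u) := rfl

lemma topForm_apply {n : ℕ} (e : Module.Basis (Fin n) ℝ V) (w : V [⋀^Fin n]→L[ℝ] ℝ)
    (v : Fin n → V) : w v = w e * e.det v :=
  congrArg (fun g : V [⋀^Fin n]→ₗ[ℝ] ℝ => g v) (w.toAlternatingMap.eq_smul_basis_det e)

lemma topForm_comp {n : ℕ} (e : Module.Basis (Fin n) ℝ V) (w : V [⋀^Fin n]→L[ℝ] ℝ)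
    (T : V →ₗ[ℝ] V) : w (fun i => T (e i)) = LinearMap.det T * w e := by
  have h : (fun i => T (e i)) = T ∘ e := rfl
  rw [topForm_apply e w, h, e.det_comp, e.det_self]
  ring

lemma alternating_comp_basis_of_not_injective {k n : ℕ} (e : Fin n → V) (w : V [⋀^Fin k]→L[ℝ] ℝ)
    {I : Fin k → Fin n} (hI : ¬ Function.Injective I) : w (fun j => e (I j)) = 0 := by
  refine w.toAlternatingMap.map_eq_zero_of_not_injective _ fun h => hI ?_
  exact Function.Injective.of_comp (f := e) h

lemma alternating_comp_perm {k : ℕ} (w : V [⋀^Fin k]→L[ℝ] ℝ) (v : Fin k → V)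
    (σ : Equiv.Perm (Fin k)) : w (fun j => v (σ j)) = (σ.sign : ℤ) * w v := by
  have := w.toAlternatingMap.map_perm v σ
  rw [Units.smul_def, zsmul_eq_mul] at this
  exact this

lemma sign_mul_sign {k : ℕ} (σ : Equiv.Perm (Fin k)) : (((σ.sign : ℤ) : ℝ)) * (σ.sign : ℤ) = 1 := by
  rcases Int.units_eq_one_or σ.sign with h | h <;> simp [h]

/-- Values of two forms of top degree on a family of basis vectors. -/
lemma topForm_mul_topForm {n : ℕ} (e : Fin n → V) (θ w : V [⋀^Fin n]→L[ℝ] ℝ)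
    (I : Fin n → Fin n) [Decidable (Function.Injective I)] :
    θ (fun j => e (I j)) * w (fun j => e (I j)) =
      if Function.Injective I then θ e * w e else 0 := by
  split_ifs with hI
  · let σ : Equiv.Perm (Fin n) := Equiv.ofBijective I (Finite.injective_iff_bijective.1 hI)
    have h1 := alternating_comp_perm θ e σ
    have h2 := alternating_comp_perm w e σ
    change θ (fun j => e (σ j)) * w (fun j => e (σ j)) = _
    rw [h1, h2]
    linear_combination (θ e * w e) * sign_mul_sign σ
  · rw [alternating_comp_basis_of_not_injective e θ hI, zero_mul]

open Classical in
lemma card_injective (n : ℕ) :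
    (Finset.univ.filter fun I : Fin n → Fin n => Function.Injective I).card = n.factorial := by
  rw [← Fintype.card_subtype, Fintype.card_congr (Equiv.subtypeInjectiveEquivEmbedding _ _),
    Fintype.card_embedding_eq]
  simp [Nat.descFactorial_self]

open Classical in
lemma card_injective_cons {k : ℕ} (a : Fin (k + 1)) :
    (Finset.univ.filter fun I : Fin k → Fin (k + 1) =>
      Function.Injective (Fin.cons a I : Fin (k + 1) → Fin (k + 1))).card = k.factorial := by
  have E : {I : Fin k → Fin (k + 1) //
      Function.Injective (Fin.cons a I : Fin (k + 1) → Fin (k + 1))} ≃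
      (Fin k ↪ {x : Fin (k + 1) // x ≠ a}) :=
    { toFun := fun I => ⟨fun i => ⟨I.1 i, fun h => (Fin.cons_injective_iff.1 I.2).1 ⟨i, h⟩⟩,
        fun i j h => (Fin.cons_injective_iff.1 I.2).2 (congrArg Subtype.val h)⟩
      invFun := fun g => ⟨fun i => (g i).1, Fin.cons_injective_iff.2
        ⟨fun ⟨i, h⟩ => (g i).2 h, fun i j h => g.injective (Subtype.ext h)⟩⟩
      left_inv := fun I => rfl
      right_inv := fun g => rfl }
  rw [← Fintype.card_subtype, Fintype.card_congr E, Fintype.card_embedding_eq]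
  simp [Nat.descFactorial_self, Fintype.card_subtype_compl]

lemma sum_topForm_mul_topForm {n : ℕ} (e : Fin n → V) (θ w : V [⋀^Fin n]→L[ℝ] ℝ) :
    ∑ I : Fin n → Fin n, θ (fun j => e (I j)) * w (fun j => e (I j)) =
      n.factorial * (θ e * w e) := by
  classical
  simp_rw [topForm_mul_topForm, ← Finset.sum_filter, Finset.sum_const, card_injective,
    nsmul_eq_mul]

lemma vecCons_comp {k n : ℕ} (e : Fin n → V) (a : Fin n) (I : Fin k → Fin n) :
    (Matrix.vecCons (e a) fun j => e (I j)) =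
      fun j => e ((Fin.cons a I : Fin (k + 1) → Fin n) j) := by
  funext j
  refine Fin.cases ?_ (fun i => ?_) j <;> simp

/-- The contractions of `w` with the basis vectors are orthogonal. A tuple of `k` distinct indices
out of `k + 1` omits exactly one, so it cannot be extended injectively by two different indices. For
`a = b` the `k!` injective extensions contribute `1` each. -/
lemma sum_topForm_cons {k : ℕ} (e : Fin (k + 1) → V) (w : V [⋀^Fin (k + 1)]→L[ℝ] ℝ)
    (hw : w e * w e = 1) (a b : Fin (k + 1)) :
    ∑ I : Fin k → Fin (k + 1), w (Matrix.vecCons (e a) fun j => e (I j)) *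
      w (Matrix.vecCons (e b) fun j => e (I j)) = if a = b then (k.factorial : ℝ) else 0 := by
  classical
  split_ifs with hab
  · subst hab
    simp_rw [vecCons_comp, topForm_mul_topForm, ← Finset.sum_filter, Finset.sum_const,
      card_injective_cons, nsmul_eq_mul, hw, mul_one]
  · refine Finset.sum_eq_zero fun I _ => ?_
    rw [vecCons_comp, vecCons_comp]
    by_cases ha : Function.Injective (Fin.cons a I : Fin (k + 1) → Fin (k + 1))
    · rw [alternating_comp_basis_of_not_injective e w (I := Fin.cons b I), mul_zero]
      intro hb
      obtain ⟨j, hj⟩ := (Finite.injective_iff_surjective.1 ha) b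
      refine Fin.cases (fun hj => hab (by simpa using hj)) (fun i hj => ?_) j hj
      exact (Fin.cons_injective_iff.1 hb).1 ⟨i, by simpa using hj⟩
    · rw [alternating_comp_basis_of_not_injective e w ha, zero_mul]

/-- The vector whose interior product with the top form `w` is `β`. -/
noncomputable def contractingVector {k : ℕ} (e : Fin (k + 1) → V) (w : V [⋀^Fin (k + 1)]→L[ℝ] ℝ)
    (β : V [⋀^Fin k]→L[ℝ] ℝ) : V :=
  ∑ a, (β (fun j => e (a.succAbove j)) *
    w (Matrix.vecCons (e a) fun j => e (a.succAbove j))) • e a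

lemma topForm_vecCons_sum {k : ℕ} {ι : Type*} (s : Finset ι) (c : ι → ℝ) (e : ι → V)
    (w : V [⋀^Fin (k + 1)]→L[ℝ] ℝ) (v : Fin k → V) :
    w (Matrix.vecCons (∑ a ∈ s, c a • e a) v) = ∑ a ∈ s, c a * w (Matrix.vecCons (e a) v) := by
  let L : V →ₗ[ℝ] ℝ :=
    { toFun := fun u => w (Matrix.vecCons u v)
      map_add' := fun x y =>
        congrArg (fun g : V [⋀^Fin k]→ₗ[ℝ] ℝ => g v) (w.toAlternatingMap.curryLeft.map_add x y)
      map_smul' := fun r x =>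
        congrArg (fun g : V [⋀^Fin k]→ₗ[ℝ] ℝ => g v) (w.toAlternatingMap.curryLeft.map_smul r x) }
  change L _ = ∑ a ∈ s, c a * L (e a)
  simp

/-- It is enough to test on injective families `K`. Such a family omits a single index `b`, hence is
a permutation of `b.succAbove`; there only the summand `a = b` survives, and `w e * w e = 1` removes
the sign. -/
lemma interior_contractingVector {k : ℕ} (e : Module.Basis (Fin (k + 1)) ℝ V)
    (w : V [⋀^Fin (k + 1)]→L[ℝ] ℝ) (hw : w e * w e = 1) (β : V [⋀^Fin k]→L[ℝ] ℝ) :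
    interior (contractingVector e w β) w = β := by
  classical
  apply ContinuousAlternatingMap.toAlternatingMap_injective
  refine Module.Basis.ext_alternating e fun K hK => ?_
  change w (Matrix.vecCons _ _) = β _
  obtain ⟨b, hb⟩ : ∃ b, b ∉ Set.range K := by
    by_contra! h
    have := Fintype.card_le_of_surjective K fun b => h b
    simp at this
  have hex : ∀ i, ∃ j, b.succAbove j = K i := fun i =>
    Fin.exists_succAbove_eq fun h => hb ⟨i, h⟩
  choose p hp using hex
  have hpi : Function.Injective p := fun i j h => hK (by rw [← hp, ← hp, h])
  let σ : Equiv.Perm (Fin k) := Equiv.ofBijective p (Finite.injective_iff_bijective.1 hpi)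
  have hKσ : ∀ i, e (K i) = e (b.succAbove (σ i)) := fun i => by rw [← hp i]; rfl
  simp_rw [hKσ]
  have h1 := alternating_comp_perm β (fun j => e (b.succAbove j)) σ
  have h2 := alternating_comp_perm (interior (contractingVector e w β) w)
    (fun j => e (b.succAbove j)) σ
  rw [interior_apply] at h2
  rw [h1, h2, interior_apply, contractingVector, topForm_vecCons_sum, Finset.sum_eq_single b]
  · have h3 := topForm_mul_topForm e w w (Fin.cons b b.succAbove)
    rw [if_pos (Fin.cons_injective_iff.2 ⟨fun ⟨i, hi⟩ => Fin.succAbove_ne b i hi,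
      Fin.succAbove_right_injective⟩), hw] at h3
    rw [← vecCons_comp] at h3
    rw [mul_assoc, h3, mul_one]
  · intro a _ hab
    obtain ⟨i, hi⟩ := Fin.exists_succAbove_eq hab
    rw [vecCons_comp e a b.succAbove, alternating_comp_basis_of_not_injective e w, mul_zero]
    intro h
    exact (Fin.cons_injective_iff.1 h).1 ⟨i, hi⟩
  · simp

/-- The Hodge star leaves the last slot of the volume form free, the interior product fills the
first one. A cyclic rotation relates the two and is the source of the sign in `sharp_hodge_eq`. -/
lemma topForm_snoc {k : ℕ} (w : V [⋀^Fin (k + 1)]→L[ℝ] ℝ) (u : V) (v : Fin k → V) :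
    w (Fin.snoc (α := fun _ => V) v u) =
      (((finRotate (k + 1)).sign : ℤ) : ℝ) * w (Matrix.vecCons u v) := by
  rw [Fin.snoc_eq_cons_rotate]
  exact alternating_comp_perm w (Matrix.vecCons u v) (finRotate (k + 1))

lemma insertFirst_one {k : ℕ} (a : Fin k → V) (w : V [⋀^Fin (k + 1)]→L[ℝ] ℝ) (u : Fin 1 → V) :
    insertFirst rfl a w u = w (Fin.snoc (α := fun _ => V) a (u 0)) := by
  change w (fun j => Fin.append a u (Fin.cast _ j)) = _
  congr 1
  funext j
  simp only [Fin.cast_refl, id]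
  rw [Fin.append_right_eq_snoc]

/-- In dimension `k + 1`, the vector metrically dual to the Hodge star of a `k`-form `β`
represents `β` by interior product with the volume form, up to a sign. -/
lemma sharp_hodge_eq {k : ℕ} (e : Module.Basis (Fin (k + 1)) ℝ V)
    (w : V [⋀^Fin (k + 1)]→L[ℝ] ℝ) (hw : w e * w e = 1) (β : V [⋀^Fin k]→L[ℝ] ℝ) :
    ∑ i, (((k.factorial : ℝ)⁻¹) • ∑ I : Fin k → Fin (k + 1),
      β (fun j => e (I j)) • insertFirst rfl (fun j => e (I j)) w) (fun _ => e i) • e i =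
      (((finRotate (k + 1)).sign : ℤ) : ℝ) • contractingVector e w β := by
  classical
  set c : Fin (k + 1) → ℝ := fun a => β (fun j => e (a.succAbove j)) *
    w (Matrix.vecCons (e a) fun j => e (a.succAbove j)) with hc
  -- Expanding `β` in the contractions of `w` with the basis turns the Hodge sum into the
  -- orthogonality relation `sum_topForm_cons`.
  have hβ : ∀ v : Fin k → V, β v = ∑ a, c a * w (Matrix.vecCons (e a) v) := fun v =>
    (congrArg (fun g : V [⋀^Fin k]→L[ℝ] ℝ => g v)
      (interior_contractingVector e w hw β)).symm.trans (topForm_vecCons_sum _ c e w v)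
  conv_rhs => rw [contractingVector, Finset.smul_sum]
  refine Finset.sum_congr rfl fun i _ => ?_
  rw [smul_smul]
  congr 1
  rw [ContinuousAlternatingMap.smul_apply, ContinuousAlternatingMap.sum_apply]
  simp only [ContinuousAlternatingMap.smul_apply, insertFirst_one, topForm_snoc, smul_eq_mul]
  have h : ∑ I : Fin k → Fin (k + 1), β (fun j => e (I j)) *
      ((((finRotate (k + 1)).sign : ℤ) : ℝ) * w (Matrix.vecCons (e i) fun j => e (I j))) =
      (((finRotate (k + 1)).sign : ℤ) : ℝ) * (c i * k.factorial) := by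
    simp_rw [hβ, Finset.sum_mul]
    rw [Finset.sum_comm]
    have : ∀ a, ∑ I : Fin k → Fin (k + 1), c a * w (Matrix.vecCons (e a) fun j => e (I j)) *
        ((((finRotate (k + 1)).sign : ℤ) : ℝ) * w (Matrix.vecCons (e i) fun j => e (I j))) =
        (((finRotate (k + 1)).sign : ℤ) : ℝ) * c a * (if a = i then (k.factorial : ℝ) else 0) := by
      intro a
      rw [← sum_topForm_cons e w hw a i, Finset.mul_sum]
      exact Finset.sum_congr rfl fun I _ => by ring
    simp_rw [this]
    simp
    ring
  rw [h]
  have hk : (k.factorial : ℝ) ≠ 0 := by positivity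
  field_simp
  rfl

/-- `λ ∧ w = 0` for a form `w` of top degree, contracted with a vector `J`. -/
lemma sum_removeNth {k : ℕ} (e : Module.Basis (Fin (k + 1)) ℝ V) (w : V [⋀^Fin (k + 1)]→L[ℝ] ℝ)
    (l : V →ₗ[ℝ] ℝ) (J : V) :
    ∑ i : Fin (k + 1), (-1) ^ (i : ℕ) * (l (e i) * interior J w (i.removeNth e)) = l J * w e := by
  classical
  have hJ : J = ∑ a, e.repr J a • e a := (e.sum_repr J).symm
  have h1 : ∀ i : Fin (k + 1), interior J w (i.removeNth e) = e.repr J i * ((-1) ^ (i : ℕ) * w e) := by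
    intro i
    conv_lhs => rw [interior_apply, hJ, topForm_vecCons_sum]
    rw [Finset.sum_eq_single i]
    · congr 1
      have := w.toAlternatingMap.map_insertNth i (e i) (i.removeNth e)
      rw [Fin.insertNth_self_removeNth] at this
      change w e = (-1) ^ (i : ℕ) • w (Matrix.vecCons (e i) (i.removeNth e)) at this
      rw [zsmul_eq_mul] at this
      push_cast at this
      rw [this, ← mul_assoc, ← mul_pow]
      simp
    · intro a _ hai
      obtain ⟨j, hj⟩ := Fin.exists_succAbove_eq hai
      have : w (Matrix.vecCons (e a) (i.removeNth e)) = 0 := by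
        refine w.map_eq_zero_of_eq _ (i := 0) (j := j.succ) ?_ (Fin.succ_ne_zero j).symm
        simp [Fin.removeNth, hj]
      rw [this, mul_zero]
    · simp
  simp_rw [h1]
  conv_rhs => rw [hJ, map_sum, Finset.sum_mul]
  refine Finset.sum_congr rfl fun i _ => ?_
  rw [map_smul, smul_eq_mul]
  have : ((-1 : ℝ) ^ (i : ℕ)) * (-1) ^ (i : ℕ) = 1 := by rw [← mul_pow]; simp
  linear_combination (l (e i) * e.repr J i * w e) * this

lemma alternating_eq_zero_of_finrank_lt {n k : ℕ} (e : Module.Basis (Fin n) ℝ V) (h : n < k)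
    (θ : V [⋀^Fin k]→L[ℝ] ℝ) : θ = 0 := by
  apply ContinuousAlternatingMap.toAlternatingMap_injective
  refine Module.Basis.ext_alternating e fun K hK => ?_
  have := Fintype.card_le_of_injective K hK
  simp at this
  omega

end TopDegree

/-! ### Change of frame in contractions of multilinear maps. -/

section Multilinear

variable {V : Type*} [AddCommGroup V] [Module ℝ V] [TopologicalSpace V]

/-- Contraction of two multilinear maps over a family of vectors, after a change of the family. -/
lemma sum_multilinear_change {k n : ℕ} (α γ : MultilinearMap ℝ (fun _ : Fin k => V) ℝ)
    (f u : Fin n → V) (A : Matrix (Fin n) (Fin n) ℝ) (hA : ∀ i, f i = ∑ p, A i p • u p) :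
    ∑ I : Fin k → Fin n, α (fun j => f (I j)) * γ (fun j => f (I j)) =
      ∑ P : Fin k → Fin n, ∑ Q : Fin k → Fin n,
        (∏ a, (A.transpose * A) (P a) (Q a)) * (α (fun j => u (P j)) * γ (fun j => u (Q j))) := by
  have expand : ∀ (β : MultilinearMap ℝ (fun _ : Fin k => V) ℝ) (I : Fin k → Fin n),
      β (fun j => f (I j)) = ∑ P : Fin k → Fin n, (∏ a, A (I a) (P a)) * β (fun j => u (P j)) := by
    intro β I
    simp_rw [hA]
    rw [β.map_sum]
    refine Finset.sum_congr rfl fun P _ => ?_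
    rw [β.map_smul_univ, smul_eq_mul]
  have hprod : ∀ P Q : Fin k → Fin n, ∏ a, (A.transpose * A) (P a) (Q a) =
      ∑ I : Fin k → Fin n, (∏ a, A (I a) (P a)) * ∏ a, A (I a) (Q a) := by
    intro P Q
    simp_rw [Matrix.mul_apply, Matrix.transpose_apply, ← Finset.prod_mul_distrib]
    rw [Finset.prod_univ_sum, Fintype.piFinset_univ]
  simp_rw [expand, hprod, Finset.sum_mul_sum, Finset.sum_mul]
  rw [Finset.sum_comm]
  refine Finset.sum_congr rfl fun P _ => ?_
  rw [Finset.sum_comm]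
  refine Finset.sum_congr rfl fun Q _ => Finset.sum_congr rfl fun I _ => ?_
  ring

/-- The first slots of an alternating form, the last ones being filled with `u`. -/
def firstSlots {k l n : ℕ} (h : k + l = n) (u : Fin l → V) (θ : V [⋀^Fin n]→L[ℝ] ℝ) :
    MultilinearMap ℝ (fun _ : Fin k => V) ℝ where
  toFun a := insertFirst h a θ u
  map_update_add' := by
    intro inst a i x y
    subst h
    have key : ∀ z : V, Fin.append (Function.update a i z) u =
        Function.update (Fin.append a u) (Fin.castAdd l i) z := by
      intro z
      funext j
      refine Fin.addCases (fun j => ?_) (fun j => ?_) j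
      · rw [Fin.append_left]
        by_cases hji : j = i
        · subst hji; simp
        · rw [Function.update_of_ne hji, Function.update_of_ne, Fin.append_left]
          simpa using hji
      · rw [Fin.append_right, Function.update_of_ne, Fin.append_right]
        intro hj
        have := congrArg Fin.val hj
        simp at this
        omega
    change θ (Fin.append _ u) = θ (Fin.append _ u) + θ (Fin.append _ u)
    rw [key, key, key]
    exact θ.map_update_add _ _ _ _
  map_update_smul' := by
    intro inst a i c x
    subst h
    have key : ∀ z : V, Fin.append (Function.update a i z) u =
        Function.update (Fin.append a u) (Fin.castAdd l i) z := by
      intro z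
      funext j
      refine Fin.addCases (fun j => ?_) (fun j => ?_) j
      · rw [Fin.append_left]
        by_cases hji : j = i
        · subst hji; simp
        · rw [Function.update_of_ne hji, Function.update_of_ne, Fin.append_left]
          simpa using hji
      · rw [Fin.append_right, Function.update_of_ne, Fin.append_right]
        intro hj
        have := congrArg Fin.val hj
        simp at this
        omega
    change θ (Fin.append _ u) = c • θ (Fin.append _ u)
    rw [key, key]
    exact θ.map_update_smul _ _ _ _

end Multilinear

/-! ### Smoothness of forms and vector fields in coordinates. -/

section Smoothness

/-- A map into alternating forms is smooth as soon as its values on basis vectors are. -/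
lemma contDiffOn_alternating {n k : ℕ} {s : Set (EuclideanSpace ℝ (Fin n))}
    {f : EuclideanSpace ℝ (Fin n) → EuclideanSpace ℝ (Fin n) [⋀^Fin k]→L[ℝ] ℝ}
    (h : ∀ I : Fin k → Fin n,
      ContDiffOn ℝ ∞ (fun y => f y (fun j => EuclideanSpace.basisFun (Fin n) ℝ (I j))) s) :
    ContDiffOn ℝ ∞ f s := by
  let ev : (EuclideanSpace ℝ (Fin n) [⋀^Fin k]→L[ℝ] ℝ) →ₗ[ℝ] ((Fin k → Fin n) → ℝ) :=
    { toFun := fun θ I => θ (fun j => EuclideanSpace.basisFun (Fin n) ℝ (I j))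
      map_add' := fun _ _ => rfl
      map_smul' := fun _ _ => rfl }
  have hev : Function.Injective ev := by
    intro θ η hθ
    apply ContinuousAlternatingMap.toAlternatingMap_injective
    refine Module.Basis.ext_alternating (EuclideanSpace.basisFun (Fin n) ℝ).toBasis fun K _ => ?_
    have := congrFun hθ K
    simpa [ev] using this
  -- A left inverse of the evaluation map recovers `f` from its components by a fixed linear map,
  -- continuous because the spaces are finite-dimensional.
  obtain ⟨L, hL⟩ := ev.exists_leftInverse_of_injective (LinearMap.ker_eq_bot.2 hev)
  have hf : f = fun y => LinearMap.toContinuousLinearMap L (ev (f y)) := by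
    funext y
    exact (congrArg (fun T => T (f y)) hL).symm
  rw [hf]
  exact (LinearMap.toContinuousLinearMap L).contDiff.comp_contDiffOn (contDiffOn_pi.2 fun I => h I)

variable {n : ℕ} {D : Type*} [TopologicalSpace D] [ChartedSpace (EuclideanSpace ℝ (Fin n)) D]
  [IsManifold (𝓡 n) ∞ D]

lemma contDiffOn_alternating_apply {k : ℕ} {s : Set (EuclideanSpace ℝ (Fin n))}
    {f : EuclideanSpace ℝ (Fin n) → EuclideanSpace ℝ (Fin n) [⋀^Fin k]→L[ℝ] ℝ}
    (hf : ContDiffOn ℝ ∞ f s) (v : Fin k → EuclideanSpace ℝ (Fin n)) :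
    ContDiffOn ℝ ∞ (fun y => f y v) s :=
  (ContinuousAlternatingMap.apply ℝ (EuclideanSpace ℝ (Fin n)) ℝ v).contDiff.comp_contDiffOn hf

lemma inChart_apply {k : ℕ} (x₀ : D) (θ : Form n D k) (y : EuclideanSpace ℝ (Fin n))
    (v : Fin k → EuclideanSpace ℝ (Fin n)) :
    inChart x₀ θ y v = θ ((extChartAt (𝓡 n) x₀).symm y) (fun j =>
      mfderiv 𝓘(ℝ, EuclideanSpace ℝ (Fin n)) (𝓡 n) (extChartAt (𝓡 n) x₀).symm y (v j)) := rfl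

/-- A one-sided inverse between spaces of the same finite dimension is two-sided. All tangent spaces
unfold to the model space, so the argument takes place among its endomorphisms. -/
lemma mfderiv_symm_comp_chart' {x₀ : D} {y : EuclideanSpace ℝ (Fin n)}
    (hy : y ∈ (extChartAt (𝓡 n) x₀).target) :
    (mfderiv 𝓘(ℝ, EuclideanSpace ℝ (Fin n)) (𝓡 n) (extChartAt (𝓡 n) x₀).symm y) ∘L
    (mfderiv (𝓡 n) 𝓘(ℝ, EuclideanSpace ℝ (Fin n)) (extChartAt (𝓡 n) x₀)
      ((extChartAt (𝓡 n) x₀).symm y)) =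
      ContinuousLinearMap.id ℝ (TangentSpace (𝓡 n) ((extChartAt (𝓡 n) x₀).symm y)) := by
  have key : ∀ (S T : EuclideanSpace ℝ (Fin n) →L[ℝ] EuclideanSpace ℝ (Fin n)),
      S ∘L T = ContinuousLinearMap.id ℝ _ → T ∘L S = ContinuousLinearMap.id ℝ _ := by
    intro S T h
    have h1 : (S : EuclideanSpace ℝ (Fin n) →ₗ[ℝ] _) ∘ₗ (T : EuclideanSpace ℝ (Fin n) →ₗ[ℝ] _) =
        LinearMap.id := 
      congrArg (fun R : EuclideanSpace ℝ (Fin n) →L[ℝ] EuclideanSpace ℝ (Fin n) =>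
        (R : EuclideanSpace ℝ (Fin n) →ₗ[ℝ] EuclideanSpace ℝ (Fin n))) h
    have h2 := (LinearMap.comp_eq_id_comm ℝ _).1 h1
    ext1 v
    exact congrArg (fun R : EuclideanSpace ℝ (Fin n) →ₗ[ℝ] EuclideanSpace ℝ (Fin n) => R v) h2
  exact key _ _ (mfderiv_chart_comp_symm hy)

/-- The coordinate frame of the chart at `x₀`, at the point with coordinates `y`. -/
noncomputable def coordFrame (x₀ : D) (y : EuclideanSpace ℝ (Fin n)) (i : Fin n) :
    TangentSpace (𝓡 n) ((extChartAt (𝓡 n) x₀).symm y) :=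
  mfderiv 𝓘(ℝ, EuclideanSpace ℝ (Fin n)) (𝓡 n) (extChartAt (𝓡 n) x₀).symm y
    (EuclideanSpace.basisFun (Fin n) ℝ i)

lemma exists_basis_coordFrame {x₀ : D} {y : EuclideanSpace ℝ (Fin n)}
    (hy : y ∈ (extChartAt (𝓡 n) x₀).target) :
    ∃ u : Module.Basis (Fin n) ℝ (TangentSpace (𝓡 n) ((extChartAt (𝓡 n) x₀).symm y)),
      ∀ i, u i = coordFrame x₀ y i := by
  let A := mfderiv 𝓘(ℝ, EuclideanSpace ℝ (Fin n)) (𝓡 n) (extChartAt (𝓡 n) x₀).symm y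
  let C := mfderiv (𝓡 n) 𝓘(ℝ, EuclideanSpace ℝ (Fin n)) (extChartAt (𝓡 n) x₀)
      ((extChartAt (𝓡 n) x₀).symm y)
  have hAC : ∀ v, A (C v) = v := fun v => congrArg (fun R => R v) (mfderiv_symm_comp_chart' hy)
  have hCA : ∀ v, C (A v) = v := fun v => congrArg (fun R => R v) (mfderiv_chart_comp_symm hy)
  let E : EuclideanSpace ℝ (Fin n) ≃ₗ[ℝ] TangentSpace (𝓡 n) ((extChartAt (𝓡 n) x₀).symm y) :=
    { toFun := fun v => A v
      map_add' := fun v w => A.map_add v w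
      map_smul' := fun c v => A.map_smul c v
      invFun := fun v => C v
      left_inv := hCA
      right_inv := hAC }
  refine ⟨(EuclideanSpace.basisFun (Fin n) ℝ).toBasis.map E, fun i => ?_⟩
  rw [Module.Basis.map_apply, OrthonormalBasis.coe_toBasis]
  rfl

/-- A vector field in the coordinates of the chart at `x₀`. -/
noncomputable def vecInChart (x₀ : D) (X : VField n D) (y : EuclideanSpace ℝ (Fin n)) :
    EuclideanSpace ℝ (Fin n) :=
  mfderiv (𝓡 n) 𝓘(ℝ, EuclideanSpace ℝ (Fin n)) (extChartAt (𝓡 n) x₀)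
    ((extChartAt (𝓡 n) x₀).symm y) (X ((extChartAt (𝓡 n) x₀).symm y))

lemma mfderiv_symm_vecInChart {x₀ : D} (X : VField n D) {y : EuclideanSpace ℝ (Fin n)}
    (hy : y ∈ (extChartAt (𝓡 n) x₀).target) :
    mfderiv 𝓘(ℝ, EuclideanSpace ℝ (Fin n)) (𝓡 n) (extChartAt (𝓡 n) x₀).symm y
      (vecInChart x₀ X y) = X ((extChartAt (𝓡 n) x₀).symm y) :=
  congrArg (fun R => R (X ((extChartAt (𝓡 n) x₀).symm y))) (mfderiv_symm_comp_chart' hy)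

/-- The trivialization of the tangent bundle at `x₀` is the derivative of the chart at `x₀`, so
smoothness as a section is smoothness of these components. -/
lemma IsSmoothVField.contDiffOn {X : VField n D} (hX : IsSmoothVField X) (x₀ : D) :
    ContDiffOn ℝ ∞ (vecInChart x₀ X) (extChartAt (𝓡 n) x₀).target := by
  have h1 : ContMDiffOn (𝓡 n) 𝓘(ℝ, EuclideanSpace ℝ (Fin n)) ∞
      (fun x => mfderiv (𝓡 n) 𝓘(ℝ, EuclideanSpace ℝ (Fin n)) (extChartAt (𝓡 n) x₀) x (X x))
      (extChartAt (𝓡 n) x₀).source := by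
    intro x hx
    have hx' : x ∈ (chartAt (EuclideanSpace ℝ (Fin n)) x₀).source := by simpa using hx
    have h := ((trivializationAt (EuclideanSpace ℝ (Fin n)) (TangentSpace (𝓡 n))
      x₀).contMDiffAt_section_iff (IB := 𝓡 n) (n := ∞) (s := X) (x₀ := x) (by simpa using hx')).1
      (hX x)
    refine h.contMDiffWithinAt.congr_of_eventuallyEq_of_mem ?_ hx
    filter_upwards [self_mem_nhdsWithin] with z hz
    have hz' : z ∈ (chartAt (EuclideanSpace ℝ (Fin n)) x₀).source := by simpa using hz
    have h1 := TangentBundle.continuousLinearMapAt_trivializationAt (I := 𝓡 n) hz'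
    have h2 := Trivialization.continuousLinearMapAt_apply ℝ
      (trivializationAt (EuclideanSpace ℝ (Fin n)) (TangentSpace (𝓡 n)) x₀) z
    rw [Trivialization.coe_linearMapAt_of_mem _ (by simpa using hz')] at h2
    exact (congrArg (fun R => R (X z)) h1).symm.trans (congrFun h2 (X z))
  rw [← contMDiffOn_iff_contDiffOn]
  exact h1.comp (contMDiffOn_extChartAt_symm x₀) fun y hy => (extChartAt (𝓡 n) x₀).map_target hy

lemma inChart_iprod {k : ℕ} {x₀ : D} (X : VField n D) (θ : Form n D (k + 1))
    {y : EuclideanSpace ℝ (Fin n)} (hy : y ∈ (extChartAt (𝓡 n) x₀).target) :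
    inChart x₀ (iprod X θ) y = interior (vecInChart x₀ X y) (inChart x₀ θ y) := by
  ext v
  rw [interior_apply, inChart_apply, inChart_apply, iprod, interior_apply]
  congr 1
  funext j
  refine Fin.cases ?_ (fun i => ?_) j
  · exact (mfderiv_symm_vecInChart X hy).symm
  · rfl

lemma vec_eq_sum (v : EuclideanSpace ℝ (Fin n)) :
    v = ∑ a, v a • (EuclideanSpace.basisFun (Fin n) ℝ).toBasis a := by
  conv_lhs => rw [← (EuclideanSpace.basisFun (Fin n) ℝ).toBasis.sum_repr v]
  simp

lemma IsSmoothForm.iprod {k : ℕ} {X : VField n D} {θ : Form n D (k + 1)} (hX : IsSmoothVField X)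
    (hθ : IsSmoothForm θ) : IsSmoothForm (iprod X θ) := by
  intro x₀
  refine contDiffOn_alternating fun I => ?_
  have : ∀ y ∈ (extChartAt (𝓡 n) x₀).target,
      inChart x₀ (HallMHD.iprod X θ) y (fun j => EuclideanSpace.basisFun (Fin n) ℝ (I j)) =
      ∑ a, vecInChart x₀ X y a * inChart x₀ θ y (Matrix.vecCons
        ((EuclideanSpace.basisFun (Fin n) ℝ).toBasis a)
        (fun j => EuclideanSpace.basisFun (Fin n) ℝ (I j))) := by
    intro y hy
    rw [inChart_iprod X θ hy, interior_apply, ← topForm_vecCons_sum, ← vec_eq_sum]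
  refine ContDiffOn.congr (ContDiffOn.sum fun a _ => ContDiffOn.mul ?_ ?_) this
  · exact (EuclideanSpace.proj (𝕜 := ℝ) a).contDiff.comp_contDiffOn (hX.contDiffOn x₀)
  · exact contDiffOn_alternating_apply (hθ x₀) _

end Smoothness

/-! ### The volume form and the coefficient of a density. -/

section Volume

variable {n : ℕ} {D : Type*} [TopologicalSpace D] [ChartedSpace (EuclideanSpace ℝ (Fin n)) D]
  [RiemannianBundle (fun x : D => TangentSpace (𝓡 n) x)]

/-- `frame` need not be positively oriented, so only the square of the value is known. All later
uses are even in the frame. -/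
lemma IsRiemannianVolumeForm.mul_self {dV : Form n D n} (hdV : IsRiemannianVolumeForm dV) (x : D) :
    dV x (frame x) * dV x (frame x) = 1 := by
  have h := hdV.2 x (frame x)
  rw [← abs_mul_abs_self, h, one_mul]

/-- The `n!` injective multi-indices contribute equally, since the sign of a permutation enters
twice; the factorial in `hodge` cancels them. -/
lemma scal_eq (dV θ : Form n D n) (x : D) :
    scal dV θ x = θ x (frame x) * dV x (frame x) := by
  have h : ∀ I : Fin n → Fin n, insertFirst (Nat.add_zero n) (fun j => frame x (I j)) (dV x)
      Fin.elim0 = dV x (fun j => frame x (I j)) := by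
    intro I
    change dV x (fun j => Fin.append (fun j => frame x (I j)) Fin.elim0 (Fin.cast _ j)) = _
    congr 1
    funext j
    rw [Fin.append_elim0]
    rfl
  unfold scal hodge
  rw [ContinuousAlternatingMap.smul_apply, ContinuousAlternatingMap.sum_apply]
  simp only [ContinuousAlternatingMap.smul_apply, h, smul_eq_mul]
  have h2 := sum_topForm_mul_topForm (frame x : Fin n → TangentSpace (𝓡 n) x) (θ x) (dV x)
  have hk : (n.factorial : ℝ) ≠ 0 := by positivity
  rw [h2]
  field_simp

lemma scal_smul_eq {dV : Form n D n} (hdV : IsRiemannianVolumeForm dV) (θ : Form n D n) (x : D) :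
    θ x = scal dV θ x • dV x := by
  ext v
  have h := hdV.mul_self x
  have h1 := topForm_apply (frame x).toBasis (θ x) v
  have h2 := topForm_apply (frame x).toBasis (dV x) v
  rw [OrthonormalBasis.coe_toBasis] at h1 h2
  rw [ContinuousAlternatingMap.smul_apply, scal_eq, smul_eq_mul, h1, h2]
  linear_combination (-θ x (frame x) * (frame x).toBasis.det v) * h

variable [IsManifold (𝓡 n) ∞ D]

/-- The coefficient of a form of top degree in the chart at `x₀`. -/
noncomputable def coeffInChart (x₀ : D) (θ : Form n D n) (y : EuclideanSpace ℝ (Fin n)) : ℝ :=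
  inChart x₀ θ y (EuclideanSpace.basisFun (Fin n) ℝ)

lemma IsSmoothForm.contDiffOn_coeff {θ : Form n D n} (hθ : IsSmoothForm θ) (x₀ : D) :
    ContDiffOn ℝ ∞ (coeffInChart x₀ θ) (extChartAt (𝓡 n) x₀).target :=
  contDiffOn_alternating_apply (hθ x₀) _

lemma IsRiemannianVolumeForm.coeff_ne_zero {dV : Form n D n} (hdV : IsRiemannianVolumeForm dV)
    {x₀ : D} {y : EuclideanSpace ℝ (Fin n)} (hy : y ∈ (extChartAt (𝓡 n) x₀).target) :
    coeffInChart x₀ dV y ≠ 0 := by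
  intro h
  obtain ⟨u, hu⟩ := exists_basis_coordFrame hy
  have h1 := topForm_apply u (dV ((extChartAt (𝓡 n) x₀).symm y)) (frame _)
  have h2 : dV ((extChartAt (𝓡 n) x₀).symm y) u = 0 := by
    rw [funext hu]
    exact h
  have h3 := hdV.mul_self ((extChartAt (𝓡 n) x₀).symm y)
  rw [h1, h2] at h3
  simp at h3

lemma inChart_eq_scal_smul {dV : Form n D n} (hdV : IsRiemannianVolumeForm dV) (θ : Form n D n)
    (x₀ : D) (y : EuclideanSpace ℝ (Fin n)) :
    inChart x₀ θ y = scal dV θ ((extChartAt (𝓡 n) x₀).symm y) • inChart x₀ dV y := by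
  conv_lhs => unfold inChart
  rw [scal_smul_eq hdV θ]
  rfl

lemma IsRiemannianVolumeForm.isSmoothFun_scal {dV : Form n D n} (hdV : IsRiemannianVolumeForm dV)
    {θ : Form n D n} (hθ : IsSmoothForm θ) : IsSmoothFun (n := n) (scal dV θ) := by
  refine isSmoothFun_of_contDiffOn fun x₀ => ?_
  refine ((hθ.contDiffOn_coeff x₀).div (hdV.1.contDiffOn_coeff x₀)
    fun y hy => hdV.coeff_ne_zero hy).congr fun y hy => ?_
  refine (eq_div_iff (hdV.coeff_ne_zero hy)).2 ?_
  exact (congrArg (fun g => g (EuclideanSpace.basisFun (Fin n) ℝ))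
    (inChart_eq_scal_smul hdV θ x₀ y)).symm

end Volume

/-! ### Smoothness of the Hodge star. -/

section Hodge

variable {n : ℕ} {D : Type*} [TopologicalSpace D] [ChartedSpace (EuclideanSpace ℝ (Fin n)) D]
  [IsManifold (𝓡 n) ∞ D] [RiemannianBundle (fun x : D => TangentSpace (𝓡 n) x)]

/-- The Gram matrix of the coordinate frame of the chart at `x₀`. -/
noncomputable def gram (x₀ : D) (y : EuclideanSpace ℝ (Fin n)) : Matrix (Fin n) (Fin n) ℝ :=
  Matrix.of fun p q => inner ℝ (coordFrame x₀ y p) (coordFrame x₀ y q)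

/-- In the bundle trivialization at `x₀` the coordinate frame is constant. -/
lemma contMDiffOn_coordFrame (x₀ : D) (p : Fin n) :
    ContMDiffOn 𝓘(ℝ, EuclideanSpace ℝ (Fin n)) (𝓡 n).tangent ∞
      (fun y => (⟨(extChartAt (𝓡 n) x₀).symm y, coordFrame x₀ y p⟩ : TangentBundle (𝓡 n) D))
      (extChartAt (𝓡 n) x₀).target := by
  have hmaps : ∀ y ∈ (extChartAt (𝓡 n) x₀).target,
      (extChartAt (𝓡 n) x₀).symm y ∈ (chartAt (EuclideanSpace ℝ (Fin n)) x₀).source := by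
    intro y hy
    simpa using (extChartAt (𝓡 n) x₀).map_target hy
  rw [Trivialization.contMDiffOn_iff (IB := 𝓡 n)
    (e := trivializationAt (EuclideanSpace ℝ (Fin n)) (TangentSpace (𝓡 n)) x₀)]
  · refine ⟨contMDiffOn_extChartAt_symm x₀, ?_⟩
    refine (contMDiffOn_const (c := EuclideanSpace.basisFun (Fin n) ℝ p)).congr fun y hy => ?_
    have hz := hmaps y hy
    have h1 := TangentBundle.continuousLinearMapAt_trivializationAt (I := 𝓡 n) hz
    have h2 := Trivialization.continuousLinearMapAt_apply ℝ
      (trivializationAt (EuclideanSpace ℝ (Fin n)) (TangentSpace (𝓡 n)) x₀)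
      ((extChartAt (𝓡 n) x₀).symm y)
    rw [Trivialization.coe_linearMapAt_of_mem _ (by simpa using hz)] at h2
    refine (congrFun h2 (coordFrame x₀ y p)).symm.trans ?_
    refine (congrArg (fun R => R (coordFrame x₀ y p)) h1).trans ?_
    exact congrArg (fun R => R (EuclideanSpace.basisFun (Fin n) ℝ p)) (mfderiv_chart_comp_symm hy)
  · intro y hy
    simpa [Trivialization.mem_source] using hmaps y hy

variable [IsContMDiffRiemannianBundle (𝓡 n) ∞ (EuclideanSpace ℝ (Fin n))
    (fun x : D => TangentSpace (𝓡 n) x)]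

lemma contDiffOn_gram (x₀ : D) (p q : Fin n) :
    ContDiffOn ℝ ∞ (fun y => gram x₀ y p q) (extChartAt (𝓡 n) x₀).target := by
  rw [← contMDiffOn_iff_contDiffOn]
  exact ContMDiffOn.inner_bundle (contMDiffOn_coordFrame x₀ p) (contMDiffOn_coordFrame x₀ q)

lemma contDiffOn_det {k : ℕ} {s : Set (EuclideanSpace ℝ (Fin n))}
    {G : EuclideanSpace ℝ (Fin n) → Matrix (Fin k) (Fin k) ℝ}
    (hG : ∀ p q, ContDiffOn ℝ ∞ (fun y => G y p q) s) :
    ContDiffOn ℝ ∞ (fun y => (G y).det) s := by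
  simp_rw [Matrix.det_apply]
  refine ContDiffOn.sum fun σ _ => ?_
  exact (contDiffOn_prod fun i _ => hG _ _).const_smul _

lemma contDiffOn_matrix_inv {k : ℕ} {s : Set (EuclideanSpace ℝ (Fin n))}
    {G : EuclideanSpace ℝ (Fin n) → Matrix (Fin k) (Fin k) ℝ}
    (hG : ∀ p q, ContDiffOn ℝ ∞ (fun y => G y p q) s) (hdet : ∀ y ∈ s, (G y).det ≠ 0)
    (p q : Fin k) : ContDiffOn ℝ ∞ (fun y => (G y)⁻¹ p q) s := by
  simp_rw [Matrix.inv_def, Matrix.smul_apply, Ring.inverse_eq_inv', smul_eq_mul,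
    Matrix.adjugate_apply]
  refine ((contDiffOn_det hG).inv hdet).mul (contDiffOn_det fun i j => ?_)
  by_cases h : i = q
  · subst h
    simpa using contDiffOn_const
  · simpa [Matrix.updateRow_apply, h] using hG i j

/-- The coefficients of an orthonormal basis in the coordinate frame give the inverse of the Gram
matrix. -/
lemma exists_frame_coeff {x₀ : D} {y : EuclideanSpace ℝ (Fin n)}
    (hy : y ∈ (extChartAt (𝓡 n) x₀).target) :
    ∃ A : Matrix (Fin n) (Fin n) ℝ,
      (∀ i, frame ((extChartAt (𝓡 n) x₀).symm y) i = ∑ p, A i p • coordFrame x₀ y p) ∧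
      gram x₀ y * (A.transpose * A) = 1 := by
  obtain ⟨u, hu⟩ := exists_basis_coordFrame hy
  let x := (extChartAt (𝓡 n) x₀).symm y
  let A : Matrix (Fin n) (Fin n) ℝ := Matrix.of fun i p => u.repr (frame x i) p
  have hA : ∀ i, frame x i = ∑ p, A i p • coordFrame x₀ y p := by
    intro i
    simp_rw [← hu]
    exact (u.sum_repr (frame x i)).symm
  refine ⟨A, hA, ?_⟩
  -- This is orthonormality of the frame. A one-sided inverse of a square matrix is two-sided, so
  -- the factor `A` can then be moved to the right end.
  have h1 : A * (gram x₀ y * A.transpose) = 1 := by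
    ext i j
    have h := (orthonormal_iff_ite.1 (frame x).orthonormal) i j
    rw [hA i, hA j, sum_inner] at h
    rw [Matrix.mul_apply, Matrix.one_apply, ← h]
    refine Finset.sum_congr rfl fun p _ => ?_
    rw [real_inner_smul_left, inner_sum, Matrix.mul_apply]
    congr 1
    refine Finset.sum_congr rfl fun q _ => ?_
    rw [real_inner_smul_right, Matrix.transpose_apply, mul_comm]
    rfl
  rw [← Matrix.mul_assoc]
  exact mul_eq_one_comm.1 h1

lemma append_map {U V : Type*} {k l : ℕ} (f : U → V) (a : Fin k → U) (v : Fin l → U)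
    (j : Fin (k + l)) :
    Fin.append (fun i => f (a i)) (fun i => f (v i)) j = f (Fin.append a v j) := by
  refine Fin.addCases (fun i => ?_) (fun i => ?_) j <;> simp

/-- The orthonormal frame is chosen point by point without any regularity. Its coefficient matrix
`A` enters only through `A.transpose * A`, the inverse Gram matrix, which is smooth; hence so is the
Hodge star. -/
lemma inChart_hodge {k l : ℕ} (h : k + l = n) (dV : Form n D n) (θ : Form n D k) {x₀ : D}
    {y : EuclideanSpace ℝ (Fin n)} (hy : y ∈ (extChartAt (𝓡 n) x₀).target)
    (v : Fin l → EuclideanSpace ℝ (Fin n)) :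
    inChart x₀ (hodge dV h θ) y v = ((k.factorial : ℝ)⁻¹) * ∑ P : Fin k → Fin n,
      ∑ Q : Fin k → Fin n, (∏ a, (gram x₀ y)⁻¹ (P a) (Q a)) *
        (inChart x₀ θ y (fun j => EuclideanSpace.basisFun (Fin n) ℝ (P j)) *
          insertFirst h (fun j => EuclideanSpace.basisFun (Fin n) ℝ (Q j)) (inChart x₀ dV y) v) := by
  obtain ⟨A, hA, hG⟩ := exists_frame_coeff hy
  rw [Matrix.inv_eq_right_inv hG, inChart_apply]
  set x := (extChartAt (𝓡 n) x₀).symm y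
  set w : Fin l → TangentSpace (𝓡 n) x := fun j =>
    mfderiv 𝓘(ℝ, EuclideanSpace ℝ (Fin n)) (𝓡 n) (extChartAt (𝓡 n) x₀).symm y (v j) with hw
  have h1 := sum_multilinear_change (θ x).toMultilinearMap (firstSlots h w (dV x))
    (frame x) (coordFrame x₀ y) A hA
  unfold hodge
  rw [ContinuousAlternatingMap.smul_apply, ContinuousAlternatingMap.sum_apply, smul_eq_mul]
  congr 1
  refine h1.trans ?_
  refine Finset.sum_congr rfl fun P _ => Finset.sum_congr rfl fun Q _ => ?_
  congr 2
  change dV x _ = dV x _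
  congr 1
  funext j
  exact append_map (mfderiv 𝓘(ℝ, EuclideanSpace ℝ (Fin n)) (𝓡 n) (extChartAt (𝓡 n) x₀).symm y)
    (fun j => EuclideanSpace.basisFun (Fin n) ℝ (Q j)) v _

lemma IsSmoothForm.hodge {k l : ℕ} (h : k + l = n) {dV : Form n D n} (hdV : IsSmoothForm dV)
    {θ : Form n D k} (hθ : IsSmoothForm θ) : IsSmoothForm (hodge dV h θ) := by
  intro x₀
  refine contDiffOn_alternating fun I => ?_
  refine ContDiffOn.congr ?_ fun y hy => inChart_hodge h dV θ hy _
  refine contDiffOn_const.mul (ContDiffOn.sum fun P _ => ContDiffOn.sum fun Q _ => ?_)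
  refine (contDiffOn_prod fun a _ => ?_).mul (ContDiffOn.mul ?_ ?_)
  · refine contDiffOn_matrix_inv (contDiffOn_gram x₀) (fun y hy => ?_) _ _
    obtain ⟨A, -, hG⟩ := exists_frame_coeff (D := D) hy
    intro h0
    have := congrArg Matrix.det hG
    rw [Matrix.det_mul, h0, zero_mul, Matrix.det_one] at this
    exact zero_ne_one this
  · exact contDiffOn_alternating_apply (hθ x₀) _
  · exact contDiffOn_alternating_apply (hdV x₀) _

end Hodge

/-! ### The flux form of the dual field of a codifferential. -/

section Codifferential

variable {m : ℕ} {D : Type*} [TopologicalSpace D] [ChartedSpace (EuclideanSpace ℝ (Fin (m + 2))) D]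
  [IsManifold (𝓡 (m + 2)) ∞ D] [RiemannianBundle (fun x : D => TangentSpace (𝓡 (m + 2)) x)]
  [IsContMDiffRiemannianBundle (𝓡 (m + 2)) ∞ (EuclideanSpace ℝ (Fin (m + 2)))
    (fun x : D => TangentSpace (𝓡 (m + 2)) x)]

/-- The flux form of the field `(δσ)^♯` is exact up to sign. -/
lemma iprod_sharp_codiff {dV : Form (m + 2) D (m + 2)} (hdV : IsRiemannianVolumeForm dV)
    (σ : Form (m + 2) D 2) :
    iprod (sharp (codiff dV σ)) dV = (((finRotate (m + 2)).sign : ℤ) : ℝ) •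
      extD (hodge dV (k := 2) (l := m) (Nat.add_comm 2 m) σ) := by
  funext x
  set β := extD (hodge dV (k := 2) (l := m) (Nat.add_comm 2 m) σ)
  have h := hdV.mul_self x
  rw [← OrthonormalBasis.coe_toBasis] at h
  have h1 := sharp_hodge_eq (frame x).toBasis (dV x) h (β x)
  have h2 := interior_contractingVector (frame x).toBasis (dV x) h (β x)
  have h3 : sharp (codiff dV σ) x = (((finRotate (m + 2)).sign : ℤ) : ℝ) •
      contractingVector (frame x).toBasis (dV x) (β x) := by
    rw [← h1, OrthonormalBasis.coe_toBasis]
    rfl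
  change interior (sharp (codiff dV σ) x) (dV x) = (((finRotate (m + 2)).sign : ℤ) : ℝ) • β x
  rw [h3]
  conv_rhs => rw [← h2]
  ext v
  exact congrArg (fun g => g v) ((dV x).toAlternatingMap.curryLeft.map_smul _ _)

end Codifferential

/-! ### The Riemannian measure restricts to the chart measures. -/

section RiemannianMeasure

variable {n : ℕ} {D : Type*} [TopologicalSpace D] [ChartedSpace (EuclideanSpace ℝ (Fin n)) D]
  [IsManifold (𝓡 n) ∞ D]

lemma coeffInChart_change {x₀ x₁ : D} {y : EuclideanSpace ℝ (Fin n)} (θ : Form n D n)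
    (hy : y ∈ (extChartAt (𝓡 n) x₀).target)
    (hy' : (extChartAt (𝓡 n) x₀).symm y ∈ (extChartAt (𝓡 n) x₁).source) :
    coeffInChart x₀ θ y =
      (fderiv ℝ (transition x₀ x₁) y).det * coeffInChart x₁ θ (transition x₀ x₁ y) := by
  unfold coeffInChart
  rw [inChart_change θ hy hy', ContinuousAlternatingMap.compContinuousLinearMap_apply]
  have := topForm_comp (EuclideanSpace.basisFun (Fin n) ℝ).toBasis
    (inChart x₁ θ (transition x₀ x₁ y)) (fderiv ℝ (transition x₀ x₁) y)
  rw [OrthonormalBasis.coe_toBasis] at this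
  exact this

variable [RiemannianBundle (fun x : D => TangentSpace (𝓡 n) x)] [MeasurableSpace D] [BorelSpace D]

lemma aemeasurable_chart_symm (dV : Form n D n) (x₀ : D) :
    AEMeasurable (extChartAt (𝓡 n) x₀).symm
      ((volume.restrict (extChartAt (𝓡 n) x₀).target).withDensity fun y =>
        ENNReal.ofReal |coeffInChart x₀ dV y|) :=
  ((continuousOn_extChartAt_symm x₀).aemeasurable
    (isOpen_extChartAt_target x₀).measurableSet).mono_ac (withDensity_absolutelyContinuous _ _)

lemma measurableSet_target_inter_preimage (x₀ : D) {S : Set D} (hS : MeasurableSet S) :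
    MeasurableSet ((extChartAt (𝓡 n) x₀).target ∩ (extChartAt (𝓡 n) x₀).symm ⁻¹' S) := by
  have hT := (isOpen_extChartAt_target (I := 𝓡 n) x₀).measurableSet
  have h : Measurable ((extChartAt (𝓡 n) x₀).target.domRestrict (extChartAt (𝓡 n) x₀).symm) :=
    (continuousOn_iff_continuous_domRestrict.1 (continuousOn_extChartAt_symm x₀)).measurable
  have := (MeasurableEmbedding.subtype_coe hT).measurableSet_image.2 (h hS)
  convert this using 1
  ext y
  exact ⟨fun hy => ⟨⟨y, hy.1⟩, hy.2, rfl⟩, by rintro ⟨z, hz, rfl⟩; exact ⟨z.2, hz⟩⟩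

lemma chartMeasure_eq (dV : Form n D n) (x₀ : D) :
    chartMeasure dV x₀ = ((volume.restrict (extChartAt (𝓡 n) x₀).target).withDensity fun y =>
      ENNReal.ofReal |coeffInChart x₀ dV y|).map (extChartAt (𝓡 n) x₀).symm := rfl

lemma chartMeasure_apply (dV : Form n D n) (x₀ : D) {S : Set D} (hS : MeasurableSet S) :
    chartMeasure dV x₀ S =
      ∫⁻ y in (extChartAt (𝓡 n) x₀).target ∩ (extChartAt (𝓡 n) x₀).symm ⁻¹' S,
        ENNReal.ofReal |coeffInChart x₀ dV y| := by
  rw [chartMeasure_eq, Measure.map_apply_of_aemeasurable (aemeasurable_chart_symm dV x₀) hS, withDensity_apply',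
    Measure.restrict_restrict' (isOpen_extChartAt_target x₀).measurableSet, Set.inter_comm]

lemma chartMeasure_compl_source (dV : Form n D n) (x₀ : D) :
    chartMeasure dV x₀ (extChartAt (𝓡 n) x₀).sourceᶜ = 0 := by
  rw [chartMeasure_apply dV x₀ (isOpen_extChartAt_source x₀).measurableSet.compl]
  have : (extChartAt (𝓡 n) x₀).target ∩
      (extChartAt (𝓡 n) x₀).symm ⁻¹' (extChartAt (𝓡 n) x₀).sourceᶜ = ∅ := by
    ext y
    simp only [Set.mem_inter_iff, Set.mem_preimage, Set.mem_compl_iff, Set.mem_empty_iff_false,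
      iff_false, not_and, not_not]
    exact fun hy => (extChartAt (𝓡 n) x₀).map_target hy
  rw [this, Measure.restrict_empty, lintegral_zero_measure]

lemma image_transition (x₀ x₁ : D) {S : Set D} (hS : S ⊆ (extChartAt (𝓡 n) x₀).source) :
    (extChartAt (𝓡 n) x₁).target ∩ (extChartAt (𝓡 n) x₁).symm ⁻¹' S =
      transition x₀ x₁ '' ((extChartAt (𝓡 n) x₀).target ∩
        (extChartAt (𝓡 n) x₀).symm ⁻¹' (S ∩ (extChartAt (𝓡 n) x₁).source)) := by
  ext z
  constructor
  · rintro ⟨hz, hzS⟩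
    have h0 := hS hzS
    refine ⟨extChartAt (𝓡 n) x₀ ((extChartAt (𝓡 n) x₁).symm z),
      ⟨(extChartAt (𝓡 n) x₀).map_source h0, ?_⟩, ?_⟩
    · rw [Set.mem_preimage, (extChartAt (𝓡 n) x₀).left_inv h0]
      exact ⟨hzS, (extChartAt (𝓡 n) x₁).map_target hz⟩
    · rw [transition, (extChartAt (𝓡 n) x₀).left_inv h0, (extChartAt (𝓡 n) x₁).right_inv hz]
  · rintro ⟨y, ⟨hy, hyS, hy1⟩, rfl⟩
    refine ⟨(extChartAt (𝓡 n) x₁).map_source hy1, ?_⟩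
    rw [Set.mem_preimage, transition, (extChartAt (𝓡 n) x₁).left_inv hy1]
    exact hyS

/-- The Jacobian in the change of variables is absorbed by the transformation rule of the
coefficient of `dV`. Only an inequality holds in general, because the chart at `x₁` may miss part of
`S`. -/
lemma chartMeasure_le (dV : Form n D n) (x₀ x₁ : D) {S : Set D} (hS : MeasurableSet S)
    (hS0 : S ⊆ (extChartAt (𝓡 n) x₀).source) :
    chartMeasure dV x₁ S ≤ chartMeasure dV x₀ S := by
  rw [chartMeasure_apply dV x₁ hS, image_transition x₀ x₁ hS0]
  set T := (extChartAt (𝓡 n) x₀).target ∩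
    (extChartAt (𝓡 n) x₀).symm ⁻¹' (S ∩ (extChartAt (𝓡 n) x₁).source) with hTdef
  have hT : MeasurableSet T := measurableSet_target_inter_preimage x₀
    (hS.inter (isOpen_extChartAt_source x₁).measurableSet)
  have hinj : Set.InjOn (transition x₀ x₁ : EuclideanSpace ℝ (Fin n) → _) T := by
    rintro y ⟨hy, -, hy1⟩ z ⟨hz, -, hz1⟩ h
    exact (extChartAt (𝓡 n) x₀).symm.injOn hy hz ((extChartAt (𝓡 n) x₁).injOn hy1 hz1 h)
  rw [lintegral_image_eq_lintegral_abs_det_fderiv_mul volume hT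
    (f' := fderiv ℝ (transition x₀ x₁)) (fun y hy =>
      ((contDiffAt_transition hy.1 hy.2.2).differentiableAt
        (by simp)).hasFDerivAt.hasFDerivWithinAt) hinj]
  calc _ = ∫⁻ y in T, ENNReal.ofReal |coeffInChart x₀ dV y| := by
        refine setLIntegral_congr_fun hT fun y hy => ?_
        rw [coeffInChart_change dV hy.1 hy.2.2, abs_mul, ENNReal.ofReal_mul (abs_nonneg _)]
    _ ≤ _ := by
        rw [chartMeasure_apply dV x₀ hS]
        exact lintegral_mono_set fun y hy => ⟨hy.1, hy.2.1⟩

/-- The chart measure at `x₀`, completed by the Riemannian measure off the source, dominates every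
chart measure and therefore the supremum. Restricting this bound to the source gives the nontrivial
inequality. -/
lemma riemMeasure_restrict_source (dV : Form n D n) (x₀ : D) :
    (riemMeasure dV).restrict (extChartAt (𝓡 n) x₀).source = chartMeasure dV x₀ := by
  have hs := (isOpen_extChartAt_source (I := 𝓡 n) x₀).measurableSet
  have hle : riemMeasure dV ≤
      chartMeasure dV x₀ + (riemMeasure dV).restrict (extChartAt (𝓡 n) x₀).sourceᶜ := by
    refine iSup_le fun x₁ => Measure.le_iff.2 fun S hS => ?_
    rw [← measure_inter_add_sdiff S hs, Measure.add_apply, Measure.restrict_apply hS]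
    refine add_le_add ?_ ?_
    · exact (chartMeasure_le dV x₀ x₁ (hS.inter hs) Set.inter_subset_right).trans
        (measure_mono Set.inter_subset_left)
    · exact le_iSup (chartMeasure dV) x₁ _
  refine le_antisymm ?_ ?_
  · refine (Measure.restrict_mono le_rfl hle).trans ?_
    rw [Measure.restrict_add, Measure.restrict_restrict hs]
    simpa using Measure.restrict_le_self
  · refine Measure.le_iff.2 fun S hS => ?_
    rw [Measure.restrict_apply hS, ← measure_inter_add_sdiff S hs,
      measure_mono_null (Set.sdiff_subset_compl _ _) (chartMeasure_compl_source dV x₀), add_zero]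
    exact le_iSup (chartMeasure dV) x₀ _

lemma integral_riemMeasure [SecondCountableTopology D] {dV : Form n D n} (hdV : IsSmoothForm dV)
    (x₀ : D) {g : D → ℝ} (hg : ContinuousOn g (extChartAt (𝓡 n) x₀).source)
    (hg0 : ∀ x, x ∉ (extChartAt (𝓡 n) x₀).source → g x = 0) :
    ∫ x, g x ∂(riemMeasure dV) = ∫ y in (extChartAt (𝓡 n) x₀).target,
      |coeffInChart x₀ dV y| * g ((extChartAt (𝓡 n) x₀).symm y) := by
  have hs := (isOpen_extChartAt_source (I := 𝓡 n) x₀).measurableSet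
  have ht := (isOpen_extChartAt_target (I := 𝓡 n) x₀).measurableSet
  rw [← setIntegral_eq_integral_of_forall_compl_eq_zero (s := (extChartAt (𝓡 n) x₀).source)
    fun x hx => hg0 x hx]
  have hmeas : AEStronglyMeasurable g (chartMeasure dV x₀) := by
    rw [← riemMeasure_restrict_source]
    exact hg.aestronglyMeasurable hs
  rw [riemMeasure_restrict_source]
  have hc : AEMeasurable (fun y => ENNReal.ofReal |coeffInChart x₀ dV y|)
      (volume.restrict (extChartAt (𝓡 n) x₀).target) :=
    ((hdV.contDiffOn_coeff x₀).continuousOn.abs.aemeasurable ht).ennreal_ofReal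
  rw [chartMeasure_eq] at hmeas ⊢
  rw [integral_map (aemeasurable_chart_symm dV x₀) hmeas]
  have := integral_withDensity_eq_integral_toReal_smul₀ hc (by simp)
    (fun y => g ((extChartAt (𝓡 n) x₀).symm y))
  refine this.trans ?_
  refine integral_congr_ae (.of_forall fun y => ?_)
  simp

end RiemannianMeasure

/-! ### Extension by zero and integrals of derivatives. -/

section Extension

variable {n : ℕ} {s K : Set (EuclideanSpace ℝ (Fin n))} {g : EuclideanSpace ℝ (Fin n) → ℝ}

lemma indicator_eventuallyEq_zero (hK : IsClosed K) (h0 : ∀ y ∈ s, y ∉ K → g y = 0)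
    {y : EuclideanSpace ℝ (Fin n)} (hy : y ∉ K) : s.indicator g =ᶠ[𝓝 y] fun _ => 0 := by
  filter_upwards [hK.isOpen_compl.mem_nhds hy] with z hz
  by_cases hzs : z ∈ s
  · rw [Set.indicator_of_mem hzs, h0 z hzs hz]
  · rw [Set.indicator_of_notMem hzs]

lemma indicator_eventuallyEq_self (hs : IsOpen s) {y : EuclideanSpace ℝ (Fin n)} (hy : y ∈ s) :
    s.indicator g =ᶠ[𝓝 y] g := by
  filter_upwards [hs.mem_nhds hy] with z hz
  rw [Set.indicator_of_mem hz]

lemma hasCompactSupport_indicator (hK : IsCompact K) (h0 : ∀ y ∈ s, y ∉ K → g y = 0) :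
    HasCompactSupport (s.indicator g) :=
  HasCompactSupport.intro hK fun _ hy =>
    (indicator_eventuallyEq_zero hK.isClosed h0 hy).self_of_nhds

lemma contDiff_indicator {r : WithTop ℕ∞} (hs : IsOpen s) (hK : IsCompact K) (hKs : K ⊆ s)
    (hg : ContDiffOn ℝ r g s) (h0 : ∀ y ∈ s, y ∉ K → g y = 0) :
    ContDiff ℝ r (s.indicator g) := by
  refine contDiff_iff_contDiffAt.2 fun y => ?_
  by_cases hy : y ∈ K
  · exact (hg.contDiffAt (hs.mem_nhds (hKs hy))).congr_of_eventuallyEq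
      (indicator_eventuallyEq_self hs (hKs hy))
  · exact contDiffAt_const.congr_of_eventuallyEq (indicator_eventuallyEq_zero hK.isClosed h0 hy)

lemma integral_fderiv_apply_eq_zero {G : EuclideanSpace ℝ (Fin n) → ℝ} (hG : ContDiff ℝ 1 G)
    (hc : HasCompactSupport G) (v : EuclideanSpace ℝ (Fin n)) :
    Integrable (fun y => fderiv ℝ G y v) ∧ ∫ y, fderiv ℝ G y v = 0 := by
  have h1 : Integrable (fun y => fderiv ℝ G y v) :=
    ((hG.continuous_fderiv one_ne_zero).clm_apply continuous_const).integrable_of_hasCompactSupport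
      (hc.fderiv_apply (𝕜 := ℝ) v)
  refine ⟨h1, ?_⟩
  -- Integration by parts against the constant `1`: only the products have to be integrable, and
  -- they have compact support.
  have := integral_mul_fderiv_eq_neg_fderiv_mul_of_integrable (μ := volume) (v := v)
    (f := fun _ : EuclideanSpace ℝ (Fin n) => (1 : ℝ)) (g := G) (by simp) (by simpa using h1)
    (by simpa using hG.continuous.integrable_of_hasCompactSupport hc)
    (fun _ _ => differentiableAt_const _) (fun _ _ => hG.differentiable one_ne_zero _)
  simpa using this

end Extension

/-! ### The weak divergence of a field determines the differential of its flux form. -/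

section WeakDivergence

variable {k : ℕ} {D : Type*} [TopologicalSpace D] [ChartedSpace (EuclideanSpace ℝ (Fin (k + 1))) D]
  [IsManifold (𝓡 (k + 1)) ∞ D]

lemma extD_zeroForm_eq_zero {f : D → ℝ} (hf : IsSmoothFun (n := k + 1) f) {x : D}
    (hx : x ∉ tsupport f) : extD (zeroForm (k + 1) f) x = 0 := by
  have hy := mem_extChartAt_target (I := 𝓡 (k + 1)) x
  have h0 : (fun y => f ((extChartAt (𝓡 (k + 1)) x).symm y))
      =ᶠ[𝓝 (extChartAt (𝓡 (k + 1)) x x)] fun _ => 0 := by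
    have h1 : f =ᶠ[𝓝 x] fun _ => 0 := notMem_tsupport_iff_eventuallyEq.1 hx
    have h2 := continuousAt_extChartAt_symm'' (I := 𝓡 (k + 1)) hy
    rw [ContinuousAt, extChartAt_to_inv] at h2
    exact h2.eventually h1
  refine form_eq_of_inChart_eq (η := 0) (mem_extChartAt_source x) ?_
  rw [hf.inChart_extD_zeroForm hy, h0.fderiv_eq]
  have h1 : inChart x (0 : Form (k + 1) D 1) (extChartAt (𝓡 (k + 1)) x x) = 0 := rfl
  rw [h1]
  ext v
  simp

lemma pairing_gradient {f : D → ℝ} (hf : IsSmoothFun (n := k + 1) f) (J : VField (k + 1) D)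
    {x₀ : D} {y : EuclideanSpace ℝ (Fin (k + 1))} (hy : y ∈ (extChartAt (𝓡 (k + 1)) x₀).target) :
    pairing (extD (zeroForm (k + 1) f)) J ((extChartAt (𝓡 (k + 1)) x₀).symm y) =
      fderiv ℝ (fun y => f ((extChartAt (𝓡 (k + 1)) x₀).symm y)) y (vecInChart x₀ J y) := by
  have h := congrArg (fun g => g (fun _ => vecInChart x₀ J y)) (hf.inChart_extD_zeroForm hy)
  simp only [inChart_apply] at h
  have h2 := mfderiv_symm_vecInChart J hy
  rw [pairing, ← h2]
  exact h

variable [T2Space D] [SecondCountableTopology D]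
  [RiemannianBundle (fun x : D => TangentSpace (𝓡 (k + 1)) x)] [MeasurableSpace D] [BorelSpace D]

/-- Integration by parts, for a function supported in a chart. -/
lemma integral_pairing_gradient {dV : Form (k + 1) D (k + 1)} (hdV : IsRiemannianVolumeForm dV)
    {J : VField (k + 1) D} (hω : IsSmoothForm (iprod J dV)) {f : D → ℝ}
    (hf : IsSmoothFun (n := k + 1) f) (hfc : HasCompactSupport f) {x₀ : D}
    (hfs : tsupport f ⊆ (extChartAt (𝓡 (k + 1)) x₀).source) {s : ℝ}
    (hs : ∀ y ∈ (extChartAt (𝓡 (k + 1)) x₀).target,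
      (extChartAt (𝓡 (k + 1)) x₀).symm y ∈ tsupport f →
        |coeffInChart x₀ dV y| = s * coeffInChart x₀ dV y) :
    ∫ x, pairing (extD (zeroForm (k + 1) f)) J x ∂(riemMeasure dV) =
      -(s * ∫ y, (extChartAt (𝓡 (k + 1)) x₀).target.indicator
        (fun y => f ((extChartAt (𝓡 (k + 1)) x₀).symm y) *
          coeffInChart x₀ (extD (iprod J dV)) y) y) := by
  set T := (extChartAt (𝓡 (k + 1)) x₀).target with hTdef
  have hT : IsOpen T := isOpen_extChartAt_target x₀
  set F : EuclideanSpace ℝ (Fin (k + 1)) → ℝ := fun y => f ((extChartAt (𝓡 (k + 1)) x₀).symm y)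
    with hF
  have hFs : ContDiffOn ℝ ∞ F T := hf.contDiffOn x₀
  set K := extChartAt (𝓡 (k + 1)) x₀ '' tsupport f with hKdef
  have hK : IsCompact K := hfc.isCompact.image_of_continuousOn
    ((continuousOn_extChartAt x₀).mono hfs)
  have hKT : K ⊆ T := by
    rintro _ ⟨x, hx, rfl⟩
    exact (extChartAt (𝓡 (k + 1)) x₀).map_source (hfs hx)
  have hmem : ∀ y ∈ T, y ∉ K → (extChartAt (𝓡 (k + 1)) x₀).symm y ∉ tsupport f := by
    intro y hy hyK hx
    exact hyK ⟨_, hx, (extChartAt (𝓡 (k + 1)) x₀).right_inv hy⟩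
  have hF0 : ∀ y ∈ T, y ∉ K → F y = 0 := fun y hy hyK =>
    image_eq_zero_of_notMem_tsupport (f := f) (hmem y hy hyK)
  let e := (EuclideanSpace.basisFun (Fin (k + 1)) ℝ).toBasis
  have he : (e : Fin (k + 1) → EuclideanSpace ℝ (Fin (k + 1))) =
    EuclideanSpace.basisFun (Fin (k + 1)) ℝ := OrthonormalBasis.coe_toBasis _
  let w : Fin (k + 1) → EuclideanSpace ℝ (Fin (k + 1)) → ℝ := fun i y =>
    inChart x₀ (iprod J dV) y (i.removeNth e)
  have hw : ∀ i, ContDiffOn ℝ ∞ (w i) T := fun i => contDiffOn_alternating_apply (hω x₀) _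
  have hG0 : ∀ i, ∀ y ∈ T, y ∉ K → (F * w i) y = 0 := fun i y hy hyK => by
    rw [Pi.mul_apply, hF0 y hy hyK, zero_mul]
  have hG : ∀ i, Integrable (fun y => fderiv ℝ (T.indicator (F * w i)) y (e i)) ∧
      ∫ y, fderiv ℝ (T.indicator (F * w i)) y (e i) = 0 := fun i =>
    integral_fderiv_apply_eq_zero ((contDiff_indicator hT hK hKT (hFs.mul (hw i)) (hG0 i)).of_le
      (by exact_mod_cast le_top)) (hasCompactSupport_indicator hK (hG0 i)) _
  -- In coordinates this is `df ∧ (J ⌟ dV) = df(J) dV`.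
  have hflux : ∀ y ∈ T, fderiv ℝ F y (vecInChart x₀ J y) * coeffInChart x₀ dV y =
      ∑ i : Fin (k + 1), (-1) ^ (i : ℕ) * (fderiv ℝ F y (e i) * w i y) := by
    intro y hy
    have := sum_removeNth e (inChart x₀ dV y) (fderiv ℝ F y : EuclideanSpace ℝ (Fin (k + 1)) →ₗ[ℝ] ℝ)
      (vecInChart x₀ J y)
    rw [← inChart_iprod J dV hy] at this
    rw [coeffInChart, ← he]
    exact this.symm
  have hdiv : ∀ y ∈ T, coeffInChart x₀ (extD (iprod J dV)) y =
      ∑ i : Fin (k + 1), (-1) ^ (i : ℕ) * fderiv ℝ (w i) y (e i) := by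
    intro y hy
    rw [coeffInChart, hω.inChart_extD hy, ← he, extDeriv_apply
      ((hω.contDiffAt hy).differentiableAt (by simp))]
    refine Finset.sum_congr rfl fun i _ => ?_
    rw [zsmul_eq_mul]
    push_cast
    rfl
  -- The Leibniz rule `df ∧ ω = d(fω) - f dω` for the flux form `ω`, with `d(fω)` written as a sum
  -- of partial derivatives of functions extended by zero.
  have hcoord : ∀ y ∈ T, |coeffInChart x₀ dV y| *
      pairing (extD (zeroForm (k + 1) f)) J ((extChartAt (𝓡 (k + 1)) x₀).symm y) =
      s * (∑ i : Fin (k + 1), (-1) ^ (i : ℕ) * fderiv ℝ (T.indicator (F * w i)) y (e i) -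
        F y * coeffInChart x₀ (extD (iprod J dV)) y) := by
    intro y hy
    have h1 : ∀ i, fderiv ℝ (T.indicator (F * w i)) y (e i) =
        fderiv ℝ F y (e i) * w i y + F y * fderiv ℝ (w i) y (e i) := by
      intro i
      rw [(indicator_eventuallyEq_self hT hy).fderiv_eq, fderiv_mul
        ((hFs.contDiffAt (hT.mem_nhds hy)).differentiableAt (by simp))
        (((hw i).contDiffAt (hT.mem_nhds hy)).differentiableAt (by simp))]
      simp
      ring
    have h2 : ∑ i : Fin (k + 1), (-1) ^ (i : ℕ) * fderiv ℝ (T.indicator (F * w i)) y (e i) -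
        F y * coeffInChart x₀ (extD (iprod J dV)) y =
        fderiv ℝ F y (vecInChart x₀ J y) * coeffInChart x₀ dV y := by
      rw [hflux y hy, hdiv y hy, Finset.mul_sum, ← Finset.sum_sub_distrib]
      refine Finset.sum_congr rfl fun i _ => ?_
      rw [h1]
      ring
    rw [h2, pairing_gradient hf J hy]
    -- The sign `s` of the coefficient is known only over the support of `f`; elsewhere `df = 0` and
    -- both sides vanish.
    by_cases hyt : (extChartAt (𝓡 (k + 1)) x₀).symm y ∈ tsupport f
    · rw [hs y hy hyt]
      ring
    · have h3 := pairing_gradient hf J hy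
      rw [pairing, extD_zeroForm_eq_zero hf hyt] at h3
      change (0 : ℝ) = _ at h3
      rw [← h3, zero_mul, mul_zero, mul_zero]
  -- Only the flux form of `J` is assumed smooth, so continuity of `df(J)` is read off from `hflux`
  -- after division by the nonvanishing coefficient of `dV`.
  have hcont : ContinuousOn (pairing (extD (zeroForm (k + 1) f)) J)
      (extChartAt (𝓡 (k + 1)) x₀).source := by
    have h1 : ContinuousOn (fun y => (∑ i : Fin (k + 1), (-1) ^ (i : ℕ) *
        (fderiv ℝ F y (e i) * w i y)) / coeffInChart x₀ dV y) T := by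
      refine ContinuousOn.div (continuousOn_finsetSum _ fun i _ => continuousOn_const.mul
        (ContinuousOn.mul ?_ (hw i).continuousOn)) (hdV.1.contDiffOn_coeff x₀).continuousOn
        fun y hy => hdV.coeff_ne_zero hy
      exact (hFs.continuousOn_fderiv_of_isOpen hT (by simp)).clm_apply continuousOn_const
    refine (h1.comp (continuousOn_extChartAt x₀) fun x hx =>
      (extChartAt (𝓡 (k + 1)) x₀).map_source hx).congr fun x hx => ?_
    have hy := (extChartAt (𝓡 (k + 1)) x₀).map_source hx
    rw [Function.comp, ← hflux _ hy, mul_div_cancel_right₀ _ (hdV.coeff_ne_zero hy),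
      ← pairing_gradient hf J hy, (extChartAt (𝓡 (k + 1)) x₀).left_inv hx]
  have hint : Integrable (T.indicator (fun y => F y * coeffInChart x₀ (extD (iprod J dV)) y)) := by
    have h0 : ∀ y ∈ T, y ∉ K → F y * coeffInChart x₀ (extD (iprod J dV)) y = 0 :=
      fun y hy hyK => by rw [hF0 y hy hyK, zero_mul]
    exact (contDiff_indicator hT hK hKT (hFs.mul (hω.extD.contDiffOn_coeff x₀))
      h0).continuous.integrable_of_hasCompactSupport (hasCompactSupport_indicator hK h0)
  have hzero : ∀ x, x ∉ (extChartAt (𝓡 (k + 1)) x₀).source →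
      pairing (extD (zeroForm (k + 1) f)) J x = 0 := fun x hx => by
    rw [pairing, extD_zeroForm_eq_zero hf fun h => hx (hfs h)]
    rfl
  rw [integral_riemMeasure hdV.1 x₀ hcont hzero, setIntegral_congr_fun hT.measurableSet hcoord]
  rw [← integral_indicator hT.measurableSet]
  -- Off the target the extended functions vanish locally, so their derivatives need no cut-off, and
  -- each integrates to zero over the whole space.
  have hind : (T.indicator fun y => s * (∑ i : Fin (k + 1), (-1) ^ (i : ℕ) *
      fderiv ℝ (T.indicator (F * w i)) y (e i) - F y * coeffInChart x₀ (extD (iprod J dV)) y)) =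
      fun y => s * (∑ i : Fin (k + 1), (-1) ^ (i : ℕ) *
        fderiv ℝ (T.indicator (F * w i)) y (e i) -
          T.indicator (fun y => F y * coeffInChart x₀ (extD (iprod J dV)) y) y) := by
    funext y
    by_cases hy : y ∈ T
    · rw [Set.indicator_of_mem hy, Set.indicator_of_mem hy]
    · have : ∀ i, fderiv ℝ (T.indicator (F * w i)) y = 0 := fun i => by
        rw [(indicator_eventuallyEq_zero hK.isClosed (hG0 i) fun h => hy (hKT h)).fderiv_eq]
        simp
      rw [Set.indicator_of_notMem hy, Set.indicator_of_notMem hy]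
      simp [this]
  rw [hind, integral_const_mul, integral_sub (integrable_finsetSum _ fun i _ =>
    (hG i).1.const_mul _) hint, integral_finsetSum _ fun i _ => (hG i).1.const_mul _]
  simp_rw [integral_const_mul, (hG _).2]
  simp only [mul_zero, Finset.sum_const_zero, zero_sub, mul_neg, hF]

/-- Two fields with the same weak divergence have flux forms with the same exterior derivative. -/
lemma extD_iprod_eq_of_integral_eq {dV : Form (k + 1) D (k + 1)} (hdV : IsRiemannianVolumeForm dV)
    {J₁ J₂ : VField (k + 1) D} (h₁ : IsSmoothForm (iprod J₁ dV)) (h₂ : IsSmoothForm (iprod J₂ dV))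
    (h : ∀ f : D → ℝ, IsTestFun (k + 1) f →
      ∫ x, pairing (extD (zeroForm (k + 1) f)) J₁ x ∂(riemMeasure dV) =
      ∫ x, pairing (extD (zeroForm (k + 1) f)) J₂ x ∂(riemMeasure dV)) :
    extD (iprod J₁ dV) = extD (iprod J₂ dV) := by
  funext x₀
  set φ := extChartAt (𝓡 (k + 1)) x₀ with hφ
  set y₀ := φ x₀
  have hy₀ : y₀ ∈ φ.target := mem_extChartAt_target x₀
  have hT : IsOpen φ.target := isOpen_extChartAt_target x₀
  let q : EuclideanSpace ℝ (Fin (k + 1)) → ℝ := fun y =>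
    coeffInChart x₀ (extD (iprod J₁ dV)) y - coeffInChart x₀ (extD (iprod J₂ dV)) y
  have hq : ContDiffOn ℝ ∞ q φ.target :=
    (h₁.extD.contDiffOn_coeff x₀).sub (h₂.extD.contDiffOn_coeff x₀)
  have hc : ContDiffOn ℝ ∞ (coeffInChart x₀ dV) φ.target := hdV.1.contDiffOn_coeff x₀
  suffices hq0 : q y₀ = 0 by
    refine form_eq_of_inChart_eq (mem_extChartAt_source x₀) ?_
    ext v
    have e1 := topForm_apply (EuclideanSpace.basisFun (Fin (k + 1)) ℝ).toBasis
      (inChart x₀ (extD (iprod J₁ dV)) y₀) v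
    have e2 := topForm_apply (EuclideanSpace.basisFun (Fin (k + 1)) ℝ).toBasis
      (inChart x₀ (extD (iprod J₂ dV)) y₀) v
    rw [OrthonormalBasis.coe_toBasis] at e1 e2
    rw [e1, e2]
    congr 1
    exact sub_eq_zero.1 hq0
  by_contra hne
  set c₀ := coeffInChart x₀ dV y₀ with hc₀
  have hc₀ne : c₀ ≠ 0 := hdV.coeff_ne_zero hy₀
  -- If the difference `q` of the two divergence coefficients is nonzero at `y₀`, then near `y₀` it
  -- keeps its sign, and so does the coefficient of `dV`. A bump function supported there serves as
  -- test function.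
  have hN : ∀ᶠ y in 𝓝 y₀, 0 < q y₀ * q y ∧ 0 < c₀ * coeffInChart x₀ dV y := by
    refine Filter.Eventually.and ?_ ?_
    · exact ((hq.continuousOn.continuousAt (hT.mem_nhds hy₀)).const_mul (q y₀)).eventually
        (lt_mem_nhds (mul_self_pos.2 hne))
    · exact ((hc.continuousOn.continuousAt (hT.mem_nhds hy₀)).const_mul c₀).eventually
        (lt_mem_nhds (mul_self_pos.2 hc₀ne))
  have hN' : ∀ᶠ x in 𝓝 x₀, x ∈ φ.source ∧ 0 < q y₀ * q (φ x) ∧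
      0 < c₀ * coeffInChart x₀ dV (φ x) :=
    ((isOpen_extChartAt_source x₀).eventually_mem (mem_extChartAt_source x₀)).and
      ((continuousAt_extChartAt x₀).eventually hN)
  obtain ⟨f, -, hfs⟩ := (SmoothBumpFunction.nhds_basis_tsupport (I := 𝓡 (k + 1)) x₀).mem_iff.1 hN'
  have hf : IsSmoothFun (n := k + 1) f := f.contMDiff
  have hfc : HasCompactSupport f := f.hasCompactSupport
  have hsrc : tsupport f ⊆ φ.source := fun x hx => (hfs hx).1
  -- The chart may reverse orientation. The constant `s = ±1` is the sign of the coefficient of `dV`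
  -- on the support of the bump function.
  have habs : ∃ s : ℝ, s ≠ 0 ∧ ∀ c : ℝ, 0 < c₀ * c → |c| = s * c := by
    rcases lt_or_gt_of_ne hc₀ne with hlt | hgt
    · refine ⟨-1, by norm_num, fun c hcc => ?_⟩
      rw [abs_of_neg (neg_of_mul_pos_right hcc hlt.le)]
      ring
    · exact ⟨1, one_ne_zero, fun c hcc => by rw [abs_of_pos (pos_of_mul_pos_right hcc hgt.le), one_mul]⟩
  obtain ⟨s, hs0, hs⟩ := habs
  have hsign : ∀ y ∈ φ.target, φ.symm y ∈ tsupport f →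
      |coeffInChart x₀ dV y| = s * coeffInChart x₀ dV y := fun y hy hyf => by
    have := (hfs hyf).2.2
    rw [φ.right_inv hy] at this
    exact hs _ this
  have key := h f ⟨hf, hfc⟩
  rw [integral_pairing_gradient hdV h₁ hf hfc hsrc hsign,
    integral_pairing_gradient hdV h₂ hf hfc hsrc hsign, neg_inj, mul_right_inj' hs0] at key
  set K := φ '' tsupport f with hKdef
  have hK : IsCompact K := hfc.isCompact.image_of_continuousOn
    ((continuousOn_extChartAt x₀).mono hsrc)
  have hKT : K ⊆ φ.target := by
    rintro _ ⟨x, hx, rfl⟩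
    exact φ.map_source (hsrc hx)
  have hF0 : ∀ y ∈ φ.target, y ∉ K → f (φ.symm y) = 0 := fun y hy hyK =>
    image_eq_zero_of_notMem_tsupport fun hx => hyK ⟨_, hx, φ.right_inv hy⟩
  have hext : ∀ p : EuclideanSpace ℝ (Fin (k + 1)) → ℝ, ContDiffOn ℝ ∞ p φ.target →
      Continuous (φ.target.indicator fun y => f (φ.symm y) * p y) ∧
      HasCompactSupport (φ.target.indicator fun y => f (φ.symm y) * p y) := by
    intro p hp
    have h0 : ∀ y ∈ φ.target, y ∉ K → f (φ.symm y) * p y = 0 :=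
      fun y hy hyK => by rw [hF0 y hy hyK, zero_mul]
    exact ⟨(contDiff_indicator hT hK hKT ((hf.contDiffOn x₀).mul hp) h0).continuous,
      hasCompactSupport_indicator hK h0⟩
  obtain ⟨c1, s1⟩ := hext _ (h₁.extD.contDiffOn_coeff x₀)
  obtain ⟨c2, s2⟩ := hext _ (h₂.extD.contDiffOn_coeff x₀)
  obtain ⟨c3, s3⟩ := hext (fun y => q y₀ * q y) (contDiffOn_const.mul hq)
  -- The integral of `f q` vanishes by hypothesis. Multiplied by `q y₀` its integrand is nonnegative
  -- and positive at `y₀`, which is the contradiction.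
  have hpos : 0 < ∫ y, φ.target.indicator (fun y => f (φ.symm y) * (q y₀ * q y)) y := by
    refine c3.integral_pos_of_hasCompactSupport_nonneg_nonzero s3 (fun y => ?_) (x := y₀) ?_
    · by_cases hy : y ∈ φ.target
      · rw [Set.indicator_of_mem hy]
        by_cases hyf : φ.symm y ∈ tsupport f
        · have := (hfs hyf).2.1
          rw [φ.right_inv hy] at this
          exact mul_nonneg f.nonneg this.le
        · rw [image_eq_zero_of_notMem_tsupport hyf, zero_mul]
          exact le_rfl
      · rw [Set.indicator_of_notMem hy]
        exact le_rfl
    · rw [Set.indicator_of_mem hy₀, φ.left_inv (mem_extChartAt_source x₀), f.eq_one, one_mul]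
      exact (mul_self_pos.2 hne).ne'
  have hzero : (fun y => φ.target.indicator (fun y => f (φ.symm y) * (q y₀ * q y)) y) = fun y =>
      q y₀ * (φ.target.indicator (fun y => f (φ.symm y) *
        coeffInChart x₀ (extD (iprod J₁ dV)) y) y - φ.target.indicator (fun y => f (φ.symm y) *
        coeffInChart x₀ (extD (iprod J₂ dV)) y) y) := by
    funext y
    by_cases hy : y ∈ φ.target
    · simp only [Set.indicator_of_mem hy, q]
      ring
    · simp only [Set.indicator_of_notMem hy, sub_zero, mul_zero]
  rw [hzero, integral_const_mul, integral_sub (c1.integrable_of_hasCompactSupport s1)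
    (c2.integrable_of_hasCompactSupport s2), key, sub_self, mul_zero] at hpos
  exact lt_irrefl _ hpos

end WeakDivergence

/-! ### Gauge variations and the cancellation of the transport terms. -/

section Variations

variable {m : ℕ} {D : Type*} [TopologicalSpace D] [ChartedSpace (EuclideanSpace ℝ (Fin (m + 2))) D]
  [IsManifold (𝓡 (m + 2)) ∞ D] [RiemannianBundle (fun x : D => TangentSpace (𝓡 (m + 2)) x)]

lemma isTestForm_smul_gradient {h f : D → ℝ} (hh : IsSmoothFun (n := m + 2) h)
    (hf : IsTestFun (m + 2) f) :
    IsTestForm (fun x => h x • extD (zeroForm (m + 2) f) x) := by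
  refine ⟨IsSmoothForm.fun_smul hh hf.1.zeroForm.extD, tsupport f, hf.2.isCompact, fun x hx => ?_⟩
  have h0 : extD (zeroForm (m + 2) f) x = 0 := extD_zeroForm_eq_zero (k := m + 1) hf.1 hx
  change h x • extD (zeroForm (m + 2) f) x = 0
  rw [h0, smul_zero]

lemma iprod_fun_smul {k : ℕ} (h : D → ℝ) (X : VField (m + 2) D) (θ : Form (m + 2) D (k + 1)) :
    iprod X (fun x => h x • θ x) = iprod (fun x => h x • X x) θ := by
  funext x
  ext v
  exact (congrArg (fun g => g v) ((θ x).toAlternatingMap.curryLeft.map_smul (h x) (X x))).symm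

lemma extD_top (θ : Form (m + 2) D (m + 2)) : extD θ = 0 := by
  funext x
  obtain ⟨u, -⟩ := exists_basis_coordFrame (mem_extChartAt_target (I := 𝓡 (m + 2)) x)
  exact alternating_eq_zero_of_finrank_lt (V := TangentSpace (𝓡 (m + 2)) x) u (by omega) _

/-- Cartan's formula loses its second term since `dθ` has degree above the dimension. This makes
transport of densities a statement about flux forms only. -/
lemma lieD_top (X : VField (m + 2) D) (θ : Form (m + 2) D (m + 2)) :
    lieD (k := m + 1) X θ = extD (iprod (k := m + 1) X θ) := by
  unfold lieD
  rw [extD_top]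
  have : iprod X (0 : Form (m + 2) D (m + 2 + 1)) = 0 := rfl
  rw [this, add_zero]

lemma pairing_fun_smul (h : D → ℝ) (α : Form (m + 2) D 1) (X : VField (m + 2) D) :
    pairing (fun x => h x • α x) X = pairing α (fun x => h x • X x) := by
  funext x
  have h1 := (α x).toMultilinearMap.map_smul_univ (fun _ => h x) (fun _ => X x)
  rw [Fin.prod_univ_one] at h1
  exact h1.symm

variable [T2Space D] [SecondCountableTopology D] [MeasurableSpace D] [BorelSpace D]

/-- The variation `(a⋆ρ) df` of `M`. -/
noncomputable def gaugeM (dV : Form (m + 2) D (m + 2)) (a : ℝ) (Y : State m D) (f : D → ℝ) :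
    Form (m + 2) D 1 := fun x => (a * scal dV Y.ρ x) • extD (zeroForm (m + 2) f) x

/-- The variation `(⋆ñ) df` of `μ`. -/
noncomputable def gaugeμ (dV : Form (m + 2) D (m + 2)) (Y : State m D) (f : D → ℝ) :
    Form (m + 2) D 1 := fun x => scal dV Y.nt x • extD (zeroForm (m + 2) f) x

lemma IsRiemannianVolumeForm.eq_fun_smul {dV : Form (m + 2) D (m + 2)}
    (hdV : IsRiemannianVolumeForm dV) (θ : Form (m + 2) D (m + 2)) :
    θ = fun x => scal dV θ x • dV x := funext fun x => scal_smul_eq hdV θ x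

lemma flux_nt {dV : Form (m + 2) D (m + 2)} (hdV : IsRiemannianVolumeForm dV) (Y : State m D)
    (X : VField (m + 2) D) :
    iprod (k := m + 1) (fun x => scal dV Y.nt x • X x) dV = iprod (k := m + 1) X Y.nt := by
  conv_rhs => rw [hdV.eq_fun_smul Y.nt]
  rw [iprod_fun_smul]

lemma flux_ρ {dV : Form (m + 2) D (m + 2)} (hdV : IsRiemannianVolumeForm dV) (Y : State m D)
    (X : VField (m + 2) D) (c : ℝ) :
    iprod (k := m + 1) (fun x => (c * scal dV Y.ρ x) • X x) dV =
      c • iprod (k := m + 1) X Y.ρ := by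
  conv_rhs => rw [hdV.eq_fun_smul Y.ρ]
  rw [iprod_fun_smul]
  funext x
  ext v
  have := (dV x).toAlternatingMap.curryLeft.map_smul c (scal dV Y.ρ x • X x)
  rw [smul_smul] at this
  exact congrArg (fun g => g v) this

/-- If the pairings of the variational derivatives with the gauge variations cancel, then the
transport of `aρ + ñ` vanishes. -/
lemma lieD_add_eq_zero_of_integral {dV : Form (m + 2) D (m + 2)} (hdV : IsRiemannianVolumeForm dV)
    {a : ℝ} {Y : State m D} (hY : Y.Admissible dV) {X₁ X₂ : VField (m + 2) D}
    (hX₁ : IsSmoothVField X₁) (hX₂ : IsSmoothVField X₂)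
    (h : ∀ f : D → ℝ, IsTestFun (m + 2) f →
      ∫ x, pairing (gaugeμ dV Y f) X₂ x ∂(riemMeasure dV) =
      -∫ x, pairing (gaugeM dV a Y f) X₁ x ∂(riemMeasure dV)) :
    a • lieD (k := m + 1) X₁ Y.ρ + lieD (k := m + 1) X₂ Y.nt = 0 := by
  rw [lieD_top, lieD_top]
  have s1 : IsSmoothForm (iprod (k := m + 1) X₁ Y.ρ) := IsSmoothForm.iprod hX₁ hY.smooth_ρ
  have s2 : IsSmoothForm (iprod (k := m + 1) X₂ Y.nt) := IsSmoothForm.iprod hX₂ hY.smooth_nt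
  have e1 := flux_ρ hdV Y X₁ (-a)
  have e2 := flux_nt hdV Y X₂
  -- The sign goes into the second field, whose flux form is `-a` times that of `X₁` through `ρ`, so
  -- that the cancellation becomes an equality of weak divergences.
  have key := extD_iprod_eq_of_integral_eq (k := m + 1) hdV
    (J₁ := fun x => scal dV Y.nt x • X₂ x) (J₂ := fun x => (-a * scal dV Y.ρ x) • X₁ x)
    (by rw [e2]; exact s2) (by rw [e1]; exact s1.const_smul _) ?_
  · rw [e1, e2, extD_smul] at key
    rw [key]
    funext x
    ext v
    change a * extD (iprod (k := m + 1) X₁ Y.ρ) x v +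
      -a * extD (iprod (k := m + 1) X₁ Y.ρ) x v = 0
    ring
  · intro f hf
    have h1 := pairing_fun_smul (scal dV Y.nt) (extD (zeroForm (m + 2) f)) X₂
    have h2 := pairing_fun_smul (fun x => -a * scal dV Y.ρ x) (extD (zeroForm (m + 2) f)) X₁
    have h3 : pairing (fun x => (-a * scal dV Y.ρ x) • extD (zeroForm (m + 2) f) x) X₁ =
        fun x => -pairing (gaugeM dV a Y f) X₁ x := by
      funext x
      change (-a * scal dV Y.ρ x) * extD (zeroForm (m + 2) f) x (fun _ => X₁ x) =
        -((a * scal dV Y.ρ x) * extD (zeroForm (m + 2) f) x (fun _ => X₁ x))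
      ring
    rw [← h1, ← h2, h3, integral_neg]
    exact h f hf

lemma isTestForm_gaugeM {dV : Form (m + 2) D (m + 2)} (hdV : IsRiemannianVolumeForm dV)
    (a : ℝ) {Y : State m D} (hY : Y.Admissible dV) {f : D → ℝ} (hf : IsTestFun (m + 2) f) :
    IsTestForm (gaugeM dV a Y f) :=
  isTestForm_smul_gradient (contMDiff_const.mul (hdV.isSmoothFun_scal hY.smooth_ρ)) hf

lemma isTestForm_gaugeμ {dV : Form (m + 2) D (m + 2)} (hdV : IsRiemannianVolumeForm dV)
    {Y : State m D} (hY : Y.Admissible dV) {f : D → ℝ} (hf : IsTestFun (m + 2) f) :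
    IsTestForm (gaugeμ dV Y f) :=
  isTestForm_smul_gradient (hdV.isSmoothFun_scal hY.smooth_nt) hf

/-- A functional that is invariant under the gauge variations does not transport `aρ + ñ`. -/
lemma lieD_add_eq_zero_of_invariant {dV : Form (m + 2) D (m + 2)} (hdV : IsRiemannianVolumeForm dV)
    {a : ℝ} {Y : State m D} (hY : Y.Admissible dV) {F : State m D → D → ℝ} {Z : DualState m D}
    (hZ : IsVarDeriv dV F Y Z)
    (hinv : ∀ f : D → ℝ, IsTestFun (m + 2) f → ∀ (ε : ℝ) (x : D),
      F { Y with μ := Y.μ + ε • gaugeμ dV Y f } x =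
      F { Y with M := Y.M + (-ε) • gaugeM dV a Y f } x) :
    a • lieD (k := m + 1) Z.M Y.ρ + lieD (k := m + 1) Z.μ Y.nt = 0 := by
  refine lieD_add_eq_zero_of_integral hdV hY hZ.smooth_M hZ.smooth_μ fun f hf => ?_
  have h1 := hZ.deriv_μ _ (isTestForm_gaugeμ hdV hY hf)
  have h2 := hZ.deriv_M _ (isTestForm_gaugeM hdV a hY hf)
  -- The derivative in the direction of `μ` is now that of the `M`-variation run at `-ε`. The chain
  -- rule with negation and uniqueness of derivatives give the required sign.
  simp_rw [hinv f hf] at h1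
  rw [← neg_zero] at h2
  have h3 := h2.comp (0 : ℝ) (hasDerivAt_neg (0 : ℝ))
  rw [mul_neg_one] at h3
  exact h1.unique h3

lemma isSmoothForm_magForm {dV : Form (m + 2) D (m + 2)} (hdV : IsRiemannianVolumeForm dV)
    {Y : State m D} (hY : Y.Admissible dV) : IsSmoothForm (magForm dV Y) := by
  refine IsSmoothForm.fun_smul (f := fun x => (scal dV Y.nt x)⁻¹)
    (isSmoothFun_of_contDiffOn fun x₀ => ?_) hY.smooth_μ
  exact ((hdV.isSmoothFun_scal hY.smooth_nt).contDiffOn x₀).inv fun y _ => hY.nt_ne _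

/-- The weight `ñ` of the variation is chosen so that it cancels against the division by `ñ`,
leaving an exact shift. -/
lemma magForm_gauge {dV : Form (m + 2) D (m + 2)} {Y : State m D} (hY : Y.Admissible dV)
    (f : D → ℝ) (ε : ℝ) :
    magForm dV { Y with μ := Y.μ + ε • gaugeμ dV Y f } =
      magForm dV Y + ε • extD (zeroForm (m + 2) f) := by
  funext x
  have hν := hY.nt_ne x
  change (scal dV Y.nt x)⁻¹ • (Y.μ x + ε • (scal dV Y.nt x • extD (zeroForm (m + 2) f) x)) =
    (scal dV Y.nt x)⁻¹ • Y.μ x + ε • extD (zeroForm (m + 2) f) x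
  rw [smul_add, smul_comm ε, smul_smul, inv_mul_cancel₀ hν, one_smul]

/-- The factor `ñ` of the variation of `μ` cancels the denominator of `aρ/ñ`, leaving `-ε aρ df`, a
variation of `M`. -/
lemma fluidMomentum_gauge {dV : Form (m + 2) D (m + 2)} {Y : State m D} (hY : Y.Admissible dV)
    (a : ℝ) (f : D → ℝ) (ε : ℝ) :
    fluidMomentum dV a { Y with μ := Y.μ + ε • gaugeμ dV Y f } =
      fluidMomentum dV a { Y with M := Y.M + (-ε) • gaugeM dV a Y f } := by
  funext x
  have hν := hY.nt_ne x
  ext v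
  change Y.M x v - (a * scal dV Y.ρ x / scal dV Y.nt x) *
      (Y.μ x v + ε * (scal dV Y.nt x * extD (zeroForm (m + 2) f) x v)) =
    Y.M x v + (-ε) * ((a * scal dV Y.ρ x) * extD (zeroForm (m + 2) f) x v) -
      (a * scal dV Y.ρ x / scal dV Y.nt x) * Y.μ x v
  field_simp
  ring

/-- The kinetic term sees only the fluid momentum, the magnetic term only `d(μ/ñ)`, unchanged
because `d ∘ d = 0`, and the internal energy sees neither `M` nor `μ`. -/
lemma lieD_add_hamiltonian {dV : Form (m + 2) D (m + 2)} (hdV : IsRiemannianVolumeForm dV)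
    {a R : ℝ} {e : ℝ → ℝ → ℝ} {Y : State m D} (hY : Y.Admissible dV) {Z : DualState m D}
    (hZ : IsVarDeriv dV (hamiltonian dV a R e) Y Z) :
    a • lieD (k := m + 1) Z.M Y.ρ + lieD (k := m + 1) Z.μ Y.nt = 0 := by
  refine lieD_add_eq_zero_of_invariant hdV hY hZ fun f hf ε x => ?_
  have h1 : extD (magForm dV { Y with μ := Y.μ + ε • gaugeμ dV Y f }) = extD (magForm dV Y) := by
    rw [magForm_gauge hY, extD_add (isSmoothForm_magForm hdV hY)
      (hf.1.zeroForm.extD.const_smul ε), extD_smul, extD_extD hf.1.zeroForm, smul_zero, add_zero]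
  unfold hamiltonian
  rw [fluidMomentum_gauge hY, h1]
  rfl

lemma lieD_add_fluidNoise {dV : Form (m + 2) D (m + 2)} (hdV : IsRiemannianVolumeForm dV)
    {a : ℝ} {ξ : VField (m + 2) D} {Y : State m D} (hY : Y.Admissible dV) {Z : DualState m D}
    (hZ : IsVarDeriv dV (fluidNoise dV a ξ) Y Z) :
    a • lieD (k := m + 1) Z.M Y.ρ + lieD (k := m + 1) Z.μ Y.nt = 0 := by
  refine lieD_add_eq_zero_of_invariant hdV hY hZ fun f hf ε x => ?_
  unfold fluidNoise
  rw [fluidMomentum_gauge hY]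

/-- The density changes under the gauge variation, by `ε df((δσ)^♯)`, so
`lieD_add_eq_zero_of_invariant` does not apply. Here the two transport terms vanish separately: the
first because the density does not involve `M`, the second because the flux form of `(δσ)^♯` is
exact up to sign. -/
lemma lieD_add_magNoise [IsContMDiffRiemannianBundle (𝓡 (m + 2)) ∞ (EuclideanSpace ℝ (Fin (m + 2)))
      (fun x : D => TangentSpace (𝓡 (m + 2)) x)]
    {dV : Form (m + 2) D (m + 2)} (hdV : IsRiemannianVolumeForm dV)
    {a : ℝ} {σ : Form (m + 2) D 2} (hσ : IsSmoothForm σ) {Y : State m D} (hY : Y.Admissible dV)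
    {Z : DualState m D} (hZ : IsVarDeriv dV (magNoise dV σ) Y Z) :
    a • lieD (k := m + 1) Z.M Y.ρ + lieD (k := m + 1) Z.μ Y.nt = 0 := by
  have hM : ∀ f : D → ℝ, IsTestFun (m + 2) f →
      ∫ x, pairing (gaugeM dV a Y f) Z.M x ∂(riemMeasure dV) = 0 := by
    intro f hf
    have h1 := hZ.deriv_M _ (isTestForm_gaugeM hdV a hY hf)
    refine h1.unique ((hasDerivAt_const (0 : ℝ) (0 : ℝ)).congr_of_eventuallyEq (.of_forall ?_))
    intro ε
    have : ∀ x, magNoise dV σ { Y with M := Y.M + ε • gaugeM dV a Y f } x - magNoise dV σ Y x = 0 :=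
      fun x => sub_self _
    simp [this]
  have hμ : ∀ f : D → ℝ, IsTestFun (m + 2) f →
      ∫ x, pairing (gaugeμ dV Y f) Z.μ x ∂(riemMeasure dV) =
      ∫ x, pairing (extD (zeroForm (m + 2) f)) (sharp (codiff dV σ)) x ∂(riemMeasure dV) := by
    intro f hf
    have h1 := hZ.deriv_μ _ (isTestForm_gaugeμ hdV hY hf)
    have h2 : ∀ (ε : ℝ) (x : D), magNoise dV σ { Y with μ := Y.μ + ε • gaugeμ dV Y f } x -
        magNoise dV σ Y x = ε * pairing (extD (zeroForm (m + 2) f)) (sharp (codiff dV σ)) x := by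
      intro ε x
      unfold magNoise
      rw [magForm_gauge hY]
      change (pairing (magForm dV Y) (sharp (codiff dV σ)) x +
        ε * pairing (extD (zeroForm (m + 2) f)) (sharp (codiff dV σ)) x) -
          pairing (magForm dV Y) (sharp (codiff dV σ)) x = _
      ring
    simp_rw [h2, integral_const_mul] at h1
    have h3 := (hasDerivAt_id (0 : ℝ)).mul_const
      (∫ x, pairing (extD (zeroForm (m + 2) f)) (sharp (codiff dV σ)) x ∂(riemMeasure dV))
    rw [one_mul] at h3
    exact h1.unique h3
  rw [lieD_top, lieD_top]
  have s1 : IsSmoothForm (iprod (k := m + 1) Z.M Y.ρ) := IsSmoothForm.iprod hZ.smooth_M hY.smooth_ρ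
  have s2 : IsSmoothForm (iprod (k := m + 1) Z.μ Y.nt) := IsSmoothForm.iprod hZ.smooth_μ hY.smooth_nt
  have s3 : IsSmoothForm (hodge dV (k := 2) (l := m) (Nat.add_comm 2 m) σ) :=
    IsSmoothForm.hodge _ hdV.1 hσ
  have e1 := flux_ρ hdV Y Z.M a
  have e2 := flux_nt hdV Y Z.μ
  have e3 := iprod_sharp_codiff hdV σ
  -- The flux form of the zero field is presented as a zero multiple of a smooth form, which
  -- supplies its smoothness.
  have e4 : iprod (k := m + 1) (0 : VField (m + 2) D) dV = (0 : ℝ) • iprod (k := m + 1) Z.M Y.ρ := by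
    have := flux_ρ hdV Y Z.M 0
    rw [← this]
    funext x
    simp [iprod]
  have k1 := extD_iprod_eq_of_integral_eq (k := m + 1) hdV
    (J₁ := fun x => (a * scal dV Y.ρ x) • Z.M x) (J₂ := 0)
    (by rw [e1]; exact s1.const_smul _) (by rw [e4]; exact s1.const_smul _) (fun f hf => by
      have h1 := pairing_fun_smul (fun x => a * scal dV Y.ρ x) (extD (zeroForm (m + 2) f)) Z.M
      have h2 : ∀ x, pairing (extD (zeroForm (m + 2) f)) (0 : VField (m + 2) D) x = 0 := fun x =>
        (extD (zeroForm (m + 2) f) x).map_coord_zero (0 : Fin 1) rfl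
      rw [← h1]
      refine (hM f hf).trans ?_
      simp_rw [h2]
      simp)
  have k2 := extD_iprod_eq_of_integral_eq (k := m + 1) hdV
    (J₁ := fun x => scal dV Y.nt x • Z.μ x) (J₂ := sharp (codiff dV σ))
    (by rw [e2]; exact s2) (by rw [e3]; exact s3.extD.const_smul _) (fun f hf => by
      have h1 := pairing_fun_smul (scal dV Y.nt) (extD (zeroForm (m + 2) f)) Z.μ
      rw [← h1]
      exact hμ f hf)
  rw [e1, e4, extD_smul, extD_smul, zero_smul] at k1
  rw [e2, e3, extD_smul, extD_extD s3, smul_zero] at k2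
  rw [k1, k2, add_zero]

end Variations

/-! ### Cancellation of Stratonovich differentials. -/

section StochasticCalculus

variable {Ω : Type*} [MeasurableSpace Ω]

/-- An almost surely convergent subsequence for the first family is refined to one for the second.
Countable generation of the filter covers both sequences of partitions and finite partial sums over
a countable index set. -/
lemma ae_linear_of_tendstoInMeasure {P : Measure Ω} {ι : Type*} {u : Filter ι} [NeBot u]
    [u.IsCountablyGenerated] {f₁ f₂ : ι → Ω → ℝ} {g₁ g₂ : Ω → ℝ} {a : ℝ}
    (h₁ : TendstoInMeasure P f₁ u g₁) (h₂ : TendstoInMeasure P f₂ u g₂)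
    (h : ∀ᵐ o ∂P, ∀ i, a * f₁ i o + f₂ i o = 0) : ∀ᵐ o ∂P, a * g₁ o + g₂ o = 0 := by
  obtain ⟨ns, hns, h₁'⟩ := h₁.exists_seq_tendsto_ae'
  obtain ⟨ms, hms, h₂'⟩ := (h₂.comp hns).exists_seq_tendsto_ae'
  filter_upwards [h, h₁', h₂'] with o ho h1 h2
  have h3 := ((h1.comp hms).const_mul a).add h2
  refine tendsto_nhds_unique h3 ?_
  have : (fun j => a * ((fun i => f₁ (ns i) o) ∘ ms) j + (f₂ ∘ ns) (ms j) o) = fun _ => 0 :=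
    funext fun j => ho _
  rw [this]
  exact tendsto_const_nhds

/-- The uniform partition of `[0, t]` into `j + 1` intervals. -/
noncomputable def uniformPartition (t : ℝ≥0) (j k : ℕ) : ℝ≥0 :=
  ((min k (j + 1) : ℕ) : ℝ≥0) / (j + 1) * t

lemma uniformPartition_spec (t : ℝ≥0) (j : ℕ) :
    Monotone (uniformPartition t j) ∧ uniformPartition t j 0 = 0 ∧
      uniformPartition t j (j + 1) = t := by
  refine ⟨fun k l hkl => ?_, by simp [uniformPartition], ?_⟩
  · unfold uniformPartition
    gcongr
  · simp [uniformPartition]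

lemma uniformPartition_mesh (t : ℝ≥0) (δ : ℝ) (hδ : 0 < δ) :
    ∀ᶠ j : ℕ in atTop, ∀ k < j + 1,
      ((uniformPartition t j (k + 1) : ℝ) - uniformPartition t j k) < δ := by
  have h : Tendsto (fun j : ℕ => (t : ℝ) * (1 / ((j : ℝ) + 1))) atTop (𝓝 ((t : ℝ) * 0)) :=
    tendsto_one_div_add_atTop_nhds_zero_nat.const_mul _
  rw [mul_zero] at h
  filter_upwards [h.eventually (gt_mem_nhds hδ)] with j hj k hk
  have h1 : min (k + 1) (j + 1) = k + 1 := by omega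
  have h2 : min k (j + 1) = k := by omega
  unfold uniformPartition
  rw [h1, h2]
  push_cast
  refine lt_of_eq_of_lt ?_ hj
  ring

/-- The trapezoidal sums are linear in the integrand, so their combination is zero before the limit.
One admissible sequence of partitions suffices, and no property of the integrator is needed. -/
lemma IsStratonovichIntegral.linear {P : Measure Ω} {X₁ X₂ W Z₁ Z₂ : ℝ≥0 → Ω → ℝ} {a : ℝ}
    (h₁ : IsStratonovichIntegral P X₁ W Z₁) (h₂ : IsStratonovichIntegral P X₂ W Z₂)
    (h : ∀ᵐ o ∂P, ∀ t, a * X₁ t o + X₂ t o = 0) (t : ℝ≥0) :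
    ∀ᵐ o ∂P, a * Z₁ t o + Z₂ t o = 0 := by
  have hp := uniformPartition_spec t
  have hm := uniformPartition_mesh t
  refine ae_linear_of_tendstoInMeasure (h₁ t (fun j => j + 1) _ hp hm)
    (h₂ t (fun j => j + 1) _ hp hm) ?_
  filter_upwards [h] with o ho j
  rw [Finset.mul_sum, ← Finset.sum_add_distrib]
  refine Finset.sum_eq_zero fun k _ => ?_
  linear_combination ((W (uniformPartition t j (k + 1)) o - W (uniformPartition t j k) o) / 2) *
    (ho (uniformPartition t j k) + ho (uniformPartition t j (k + 1)))

/-- The coefficients cancel only up to `τ`. Stopped processes are evaluated at `t ∧ τ`, so for them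
the cancellation holds at all times. -/
lemma coe_untopA_min_le (τ : WithTop ℝ≥0) (t : ℝ≥0) :
    (((min (t : WithTop ℝ≥0) τ).untopA : ℝ≥0) : WithTop ℝ≥0) ≤ τ := by
  have h : min (t : WithTop ℝ≥0) τ ≠ ⊤ :=
    ((min_le_left _ _).trans_lt (WithTop.coe_lt_top t)).ne
  obtain ⟨r, hr⟩ := WithTop.ne_top_iff_exists.1 h
  have h2 : (r : WithTop ℝ≥0) ≤ τ := hr ▸ min_le_right _ _
  rw [← hr]
  exact h2

lemma IsStratonovichSum.linear {P : Measure Ω} {ι : Type*} [Countable ι] {τ : Ω → WithTop ℝ≥0}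
    {c₁ c₂ W : ι → ℝ≥0 → Ω → ℝ} {S₁ S₂ : ℝ≥0 → Ω → ℝ} {a : ℝ}
    (h₁ : IsStratonovichSum P τ c₁ W S₁) (h₂ : IsStratonovichSum P τ c₂ W S₂)
    (h : ∀ᵐ o ∂P, ∀ t : ℝ≥0, (t : WithTop ℝ≥0) ≤ τ o → ∀ i, a * c₁ i t o + c₂ i t o = 0)
    (t : ℝ≥0) : ∀ᵐ o ∂P, a * S₁ t o + S₂ t o = 0 := by
  obtain ⟨Z₁, hZ₁, hS₁⟩ := h₁
  obtain ⟨Z₂, hZ₂, hS₂⟩ := h₂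
  have hZ : ∀ᵐ o ∂P, ∀ i, a * Z₁ i t o + Z₂ i t o = 0 := ae_all_iff.2 fun i => by
    refine (hZ₁ i).linear (hZ₂ i) ?_ t
    filter_upwards [h] with o ho r
    exact ho _ (coe_untopA_min_le (τ o) r) i
  refine ae_linear_of_tendstoInMeasure (hS₁ t) (hS₂ t) ?_
  filter_upwards [hZ] with o ho A
  rw [Finset.mul_sum, ← Finset.sum_add_distrib]
  exact Finset.sum_eq_zero fun i _ => ho i

lemma measurableSet_timeSet (τ : Ω → WithTop ℝ≥0) (t : ℝ≥0) (o : Ω) :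
    MeasurableSet (timeSet τ t o) := by
  refine Set.OrdConnected.measurableSet ⟨fun x hx y hy z hz => ⟨hx.1.trans hz.1, hz.2.trans hy.2.1, ?_⟩⟩
  exact (WithTop.coe_le_coe.2 (Real.toNNReal_mono hz.2)).trans hy.2.2

/-- A linear combination of two processes whose stochastic differentials cancel is constant. -/
lemma SolvesSDE.linear_const {ι κ : Type*} [Countable ι] [Countable κ]
    {𝓕 : Filtration ℝ≥0 ‹MeasurableSpace Ω›} {P : Measure Ω} {τ : Ω → WithTop ℝ≥0}
    {W : ι → ℝ≥0 → Ω → ℝ} {B : κ → ℝ≥0 → Ω → ℝ} {y₁ b₁ y₂ b₂ : ℝ≥0 → Ω → ℝ}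
    {c₁ c₂ : ι → ℝ≥0 → Ω → ℝ} {g₁ g₂ : κ → ℝ≥0 → Ω → ℝ} {a : ℝ}
    (h₁ : SolvesSDE 𝓕 P τ W B y₁ b₁ c₁ g₁) (h₂ : SolvesSDE 𝓕 P τ W B y₂ b₂ c₂ g₂)
    (hb : ∀ᵐ o ∂P, ∀ t : ℝ≥0, (t : WithTop ℝ≥0) ≤ τ o → a * b₁ t o + b₂ t o = 0)
    (hc : ∀ᵐ o ∂P, ∀ t : ℝ≥0, (t : WithTop ℝ≥0) ≤ τ o → ∀ i, a * c₁ i t o + c₂ i t o = 0)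
    (hg : ∀ᵐ o ∂P, ∀ t : ℝ≥0, (t : WithTop ℝ≥0) ≤ τ o → ∀ j, a * g₁ j t o + g₂ j t o = 0)
    (t : ℝ≥0) : ∀ᵐ o ∂P, a * stoppedProcess y₁ τ t o + stoppedProcess y₂ τ t o =
      a * y₁ 0 o + y₂ 0 o := by
  obtain ⟨SW₁, SB₁, hW₁, hB₁, e₁⟩ := h₁.eqn
  obtain ⟨SW₂, SB₂, hW₂, hB₂, e₂⟩ := h₂.eqn
  filter_upwards [e₁ t, e₂ t, hb, hW₁.linear hW₂ hc t, hB₁.linear hB₂ hg t] with o h1 h2 h3 h4 h5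
  have h6 : ∫ r in timeSet τ t o, b₂ r.toNNReal o =
      ∫ r in timeSet τ t o, -a * b₁ r.toNNReal o :=
    setIntegral_congr_fun (measurableSet_timeSet τ t o) fun r hr => by
      linear_combination h3 _ hr.2.2
  rw [h1, h2, h6, integral_const_mul]
  linear_combination h4 + h5

lemma stoppedProcess_of_le {β : Type*} (u : ℝ≥0 → Ω → β) {τ : Ω → WithTop ℝ≥0} {t : ℝ≥0} {o : Ω}
    (h : (t : WithTop ℝ≥0) ≤ τ o) : stoppedProcess u τ t o = u t o := by
  unfold stoppedProcess
  rw [min_eq_left h]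
  rfl

end StochasticCalculus

/-! ### From a dense set of points and one basis to the whole form. -/

section Density

variable {n : ℕ} {D : Type*} [TopologicalSpace D] [ChartedSpace (EuclideanSpace ℝ (Fin n)) D]
  [IsManifold (𝓡 n) ∞ D]

/-- Fibres at different points cannot be compared directly, so continuity is used for the coordinate
expression in the chart around the limit point. -/
lemma IsSmoothForm.eq_zero_of_dense {k : ℕ} {θ : Form n D k} (hθ : IsSmoothForm θ) {S : Set D}
    (hS : Dense S) (h0 : ∀ x ∈ S, θ x = 0) : θ = 0 := by
  funext x₀
  refine form_eq_of_inChart_eq (η := 0) (mem_extChartAt_source x₀) ?_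
  change _ = 0
  by_contra hne
  have hy := mem_extChartAt_target (I := 𝓡 n) x₀
  have h1 : ∀ᶠ x in 𝓝 x₀, inChart x₀ θ (extChartAt (𝓡 n) x₀ x) ≠ 0 :=
    (continuousAt_extChartAt x₀).eventually
      ((hθ.contDiffAt hy).continuousAt.eventually (isOpen_ne.mem_nhds hne))
  have h2 := h1.and ((isOpen_extChartAt_source (I := 𝓡 n) x₀).eventually_mem
    (mem_extChartAt_source x₀))
  obtain ⟨x, hx, hxS⟩ := mem_closure_iff_nhds.1 (hS x₀) _ h2
  refine hx.1 ?_
  have h3 : θ ((extChartAt (𝓡 n) x₀).symm (extChartAt (𝓡 n) x₀ x)) = 0 := by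
    rw [(extChartAt (𝓡 n) x₀).left_inv hx.2]
    exact h0 x hxS
  unfold inChart
  rw [h3]
  rfl

lemma topForm_eq_zero {θ : Form n D n} {x : D}
    (h : θ x (EuclideanSpace.basisFun (Fin n) ℝ : Fin n → EuclideanSpace ℝ (Fin n)) = 0) :
    θ x = 0 := by
  ext v
  have h1 := topForm_apply (V := EuclideanSpace ℝ (Fin n))
    (EuclideanSpace.basisFun (Fin n) ℝ).toBasis (θ x) v
  rw [OrthonormalBasis.coe_toBasis] at h1
  refine h1.trans ?_
  refine (congrArg (fun r => r * _) h).trans (zero_mul _)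

end Density

end HallMHD

/-! ### The conservation law. -/

theorem mainTheorem1
    -- the domain: an oriented Riemannian manifold of dimension `m + 2`
    {m : ℕ} {D : Type*} [TopologicalSpace D] [T2Space D] [SecondCountableTopology D]
    [ChartedSpace (EuclideanSpace ℝ (Fin (m + 2))) D] [IsManifold (𝓡 (m + 2)) ∞ D]
    [RiemannianBundle (fun x : D => TangentSpace (𝓡 (m + 2)) x)]
    [IsContMDiffRiemannianBundle (𝓡 (m + 2)) ∞ (EuclideanSpace ℝ (Fin (m + 2)))
      (fun x : D => TangentSpace (𝓡 (m + 2)) x)]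
    [MeasurableSpace D] [BorelSpace D]
    (dV : Form (m + 2) D (m + 2)) (hdV : IsRiemannianVolumeForm dV)
    -- the driving noise
    {Ω : Type*} [MeasurableSpace Ω] (P : Measure Ω) [IsProbabilityMeasure P]
    (𝓕 : Filtration ℝ≥0 ‹MeasurableSpace Ω›)
    {ι κ : Type*} [Countable ι] [Countable κ]
    (W : ι → ℝ≥0 → Ω → ℝ) (hW : IsBrownianFamily 𝓕 P W)
    (B : κ → ℝ≥0 → Ω → ℝ) (hB : IsBrownianFamily 𝓕 P B)
    -- the physical parameters and the prescribed noise fields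
    (a R : ℝ) (e : ℝ → ℝ → ℝ)
    (ξ : ι → VField (m + 2) D) (hξ : ∀ i, IsSmoothVField (ξ i))
    (σ : κ → Form (m + 2) D 2) (hσ : ∀ j, IsSmoothForm (σ j))
    -- a solution on the stochastic interval `[0, τ]`
    (τ : Ω → WithTop ℝ≥0) (hτ : IsStoppingTime 𝓕 τ)
    (Y : ℝ≥0 → Ω → State m D)
    (hY : SolvesStochasticLiePoisson dV 𝓕 P τ W B (hamiltonian dV a R e)
      (fun i => fluidNoise dV a (ξ i)) (fun j => magNoise dV (σ j)) Y) :
    (∀ᵐ o ∂P, ∀ t : ℝ≥0, (t : WithTop ℝ≥0) ≤ τ o → ∀ x : D,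
      a • (Y t o).ρ x + (Y t o).nt x = a • (Y 0 o).ρ x + (Y 0 o).nt x) ∧
    ((∀ᵐ o ∂P, ∀ x : D, a • (Y 0 o).ρ x + (Y 0 o).nt x = 0) →
      ∀ᵐ o ∂P, ∀ t : ℝ≥0, (t : WithTop ℝ≥0) ≤ τ o → ∀ x : D,
        a • (Y t o).ρ x + (Y t o).nt x = 0) := by

  obtain ⟨U, Ui, ui, hU, -, hρ, -, -, hn⟩ := hY.eqn
  have hLP : ∀ᵐ o ∂P, ∀ t : ℝ≥0, (t : WithTop ℝ≥0) ≤ τ o →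
      (a • (liePoisson dV (Y t o) (U t o)).ρ + (liePoisson dV (Y t o) (U t o)).nt = 0) ∧
      (∀ i, a • (liePoisson dV (Y t o) (Ui i t o)).ρ +
        (liePoisson dV (Y t o) (Ui i t o)).nt = 0) ∧
      (∀ j, a • (liePoisson dV (Y t o) (ui j t o)).ρ +
        (liePoisson dV (Y t o) (ui j t o)).nt = 0) := by
    filter_upwards [hY.admissible, hU] with o hadm hvar t ht
    obtain ⟨h1, h2, h3⟩ := hvar t ht
    exact ⟨lieD_add_hamiltonian hdV (hadm t ht) h1,
      fun i => lieD_add_fluidNoise hdV (hadm t ht) (h2 i),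
      fun j => lieD_add_magNoise hdV (hσ j) (hadm t ht) (h3 j)⟩
  have hneg : ∀ (θ η : Form (m + 2) D (m + 2)), a • θ + η = 0 → ∀ x v,
      a * -(θ x v) + -(η x v) = 0 := fun θ η h x v => by
    have h1 : a * θ x v + η x v = 0 := congrArg (fun ζ : Form (m + 2) D (m + 2) => ζ x v) h
    linear_combination -h1
  -- A form of top degree is determined at each point by its value on one basis, so a single scalar
  -- equation per point suffices. Each tangent space unfolds to the model space, whose standard
  -- basis is used.
  let v₀ : ∀ x : D, Fin (m + 2) → TangentSpace (𝓡 (m + 2)) x := fun _ =>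
    (EuclideanSpace.basisFun (Fin (m + 2)) ℝ : Fin (m + 2) → EuclideanSpace ℝ (Fin (m + 2)))
  have hpt : ∀ (x : D) (t : ℝ≥0), ∀ᵐ o ∂P,
      a * (stoppedProcess Y τ t o).ρ x (v₀ x) + (stoppedProcess Y τ t o).nt x (v₀ x) =
        a * (Y 0 o).ρ x (v₀ x) + (Y 0 o).nt x (v₀ x) := by
    intro x t
    refine (hρ x (v₀ x)).linear_const (hn x (v₀ x)) ?_ ?_ ?_ t
    · filter_upwards [hLP] with o ho r hr
      exact hneg _ _ (ho r hr).1 x (v₀ x)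
    · filter_upwards [hLP] with o ho r hr i
      exact hneg _ _ ((ho r hr).2.1 i) x (v₀ x)
    · filter_upwards [hLP] with o ho r hr j
      exact hneg _ _ ((ho r hr).2.2 j) x (v₀ x)
  -- The null set in `hpt` depends on the point and on the time. Restricting both to countable dense
  -- sets gives one null set; pathwise continuity of the stopped process then yields all times, and
  -- smoothness all points.
  obtain ⟨S, hSc, hSd⟩ := TopologicalSpace.exists_countable_dense D
  obtain ⟨Q, hQc, hQd⟩ := TopologicalSpace.exists_countable_dense ℝ≥0
  have hall : ∀ᵐ o ∂P, ∀ x ∈ S, ∀ t ∈ Q,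
      a * (stoppedProcess Y τ t o).ρ x (v₀ x) + (stoppedProcess Y τ t o).nt x (v₀ x) =
        a * (Y 0 o).ρ x (v₀ x) + (Y 0 o).nt x (v₀ x) :=
    (ae_ball_iff hSc).2 fun x _ => (ae_ball_iff hQc).2 fun t _ => hpt x t
  have main : ∀ᵐ o ∂P, ∀ t : ℝ≥0, (t : WithTop ℝ≥0) ≤ τ o → ∀ x : D,
      a • (Y t o).ρ x + (Y t o).nt x = a • (Y 0 o).ρ x + (Y 0 o).nt x := by
    filter_upwards [hall, hY.continuous, hY.admissible] with o ho hcont hadm t ht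
    have hS : ∀ x ∈ S, ∀ r : ℝ≥0,
        a * (stoppedProcess Y τ r o).ρ x (v₀ x) + (stoppedProcess Y τ r o).nt x (v₀ x) =
          a * (Y 0 o).ρ x (v₀ x) + (Y 0 o).nt x (v₀ x) := by
      intro x hx
      have hc := (((hcont x).2.1 (v₀ x)).const_mul a).add ((hcont x).2.2.2.2 (v₀ x))
      exact congrFun (hc.ext_on hQd continuous_const fun r hr => ho x hx r hr)
    have h0 := hadm 0 (by simp)
    have ht' := hadm t ht
    let θ : Form (m + 2) D (m + 2) :=
      -- The difference of the two sides is a smooth form, since the state is admissible at time `t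
      -- ≤ τ` and at time `0`. Its vanishing on the dense set `S` is thus enough.
      (a • (Y t o).ρ + (Y t o).nt) + (-1 : ℝ) • (a • (Y 0 o).ρ + (Y 0 o).nt)
    have hθ : IsSmoothForm θ := ((ht'.smooth_ρ.const_smul a).add ht'.smooth_nt).add
      (((h0.smooth_ρ.const_smul a).add h0.smooth_nt).const_smul (-1))
    have hθ0 : θ = 0 := hθ.eq_zero_of_dense hSd fun x hx => by
      refine topForm_eq_zero ?_
      have h1 := hS x hx t
      rw [stoppedProcess_of_le Y ht] at h1
      change (a * (Y t o).ρ x (v₀ x) + (Y t o).nt x (v₀ x)) +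
        (-1) * (a * (Y 0 o).ρ x (v₀ x) + (Y 0 o).nt x (v₀ x)) = 0
      linear_combination h1
    intro x
    ext v
    have h1 : (a * (Y t o).ρ x v + (Y t o).nt x v) +
        (-1) * (a * (Y 0 o).ρ x v + (Y 0 o).nt x v) = 0 :=
      congrArg (fun ζ : Form (m + 2) D (m + 2) => ζ x v) hθ0
    change a * (Y t o).ρ x v + (Y t o).nt x v = a * (Y 0 o).ρ x v + (Y 0 o).nt x v
    linear_combination h1
  refine ⟨main, fun hinit => ?_⟩
  filter_upwards [main, hinit] with o ho hi t ht x
  rw [ho t ht x, hi x]
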